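/- Let $T=\mathbb C^2/L$ be a complex torus of dimension $2$, and let $g\colon T\to T$ be an automorphism (a biholomorphic map) such that $g^*\sigma=\lambda\sigma$ for every holomorphic symplectic form $\sigma$ on $T$, where $\lambda\in\mathbb C$ is not a root of unity. Let $S$ be the smooth Kummer surface associated to $T$, that is, the quotient of the blow-up of $T$ at the $16$ fixed points of $x\mapsto -x$ by the involution induced by $x\mapsto -x$, and let $\kappa\colon T\dashrightarrow S$ be the quotient map, defined off these fixed points. Write $g_0=g-g(0)$ (so $g_0=g$ if $g$ is a group automorphism). For a two-form $s$ on a surface $X$ put $(s,-\lambda s):=\mathrm{pr}_1^*s-\lambda\,\mathrm{pr}_2^*s$ on $X\times X$. Then: (1) for every holomorphic symplectic form $s$ on $T$, the form $(s,-\lambda s)$ on $T\times T$ is symplectic, and the graph $\{(g(x),x) : x\in T\}$ of $g$ (written with the source as second factor) is a smooth Lagrangian surface for it; (2) for every holomorphic symplectic form $s$ on $S$, the form $(s,-\lambda s)$ on $S\times S$ is symplectic, and the image in $S\times S$ of the graph of $g_0$, that is, the closure of $\{(\kappa(g_0(x)),\kappa(x)) : x\in T,\ x\neq -x\}$, is a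 smooth Lagrangian surface for it. Here a smooth Lagrangian surface for a symplectic form on a complex manifold of dimension $4$ is a closed connected complex submanifold of dimension $2$ on which the form restricts to zero. -/

import Mathlib

open scoped Manifold ContDiff Topology

/-! ### Complex tori of dimension two -/

/-- The quotient `ℂ² / L`.  When `L` is a lattice, this is a complex torus of dimension `2`, and
every such torus is of this form. -/
abbrev ComplexTorus (L : Submodule ℤ (ℂ × ℂ)) : Type :=
  (ℂ × ℂ) ⧸ L.toAddSubgroup

namespace ComplexTorus

/-- The projection `ℂ² → ℂ² / L`. -/
def proj (L : Submodule ℤ (ℂ × ℂ)) (z : ℂ × ℂ) : ComplexTorus L :=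
  QuotientAddGroup.mk z

theorem proj_eq_iff {L : Submodule ℤ (ℂ × ℂ)} {z w : ℂ × ℂ} :
    proj L z = proj L w ↔ w - z ∈ L := by
  unfold proj
  rw [QuotientAddGroup.eq, neg_add_eq_sub]
  rfl

theorem surjective_proj (L : Submodule ℤ (ℂ × ℂ)) : Function.Surjective (proj L) :=
  QuotientAddGroup.mk_surjective

variable (L : Submodule ℤ (ℂ × ℂ)) [DiscreteTopology L]

theorem isLocalHomeomorph_proj : IsLocalHomeomorph (proj L) :=
  (AddSubgroup.isAddQuotientCoveringMap_of_comm L.toAddSubgroup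
    (DiscreteTopology.isDiscrete (s := (L : Set (ℂ × ℂ))))).isCoveringMap.isLocalHomeomorph

/-- The charts of `ℂ² / L` are local inverses of the projection `ℂ² → ℂ² / L`. -/
noncomputable instance instChartedSpace : ChartedSpace (ℂ × ℂ) (ComplexTorus L) :=
  (isLocalHomeomorph_proj L).chartedSpace (surjective_proj L)

theorem symm_eq_of_mem_atlas {e : OpenPartialHomeomorph (ComplexTorus L) (ℂ × ℂ)}
    (he : e ∈ atlas (ℂ × ℂ) (ComplexTorus L)) : ⇑e.symm = proj L := by
  obtain ⟨q, rfl⟩ := he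
  ext z
  simp [OpenPartialHomeomorph.trans, IsLocalHomeomorph.localInverseAt_symm, chartAt_self_eq]

/-- The torus is a complex manifold: the changes of charts are locally translations. -/
instance instIsManifold : IsManifold 𝓘(ℂ, ℂ × ℂ) ω (ComplexTorus L) := by
  apply isManifold_of_contDiffOn
  intro e e' he he' x hx
  simp only [modelWithCornersSelf_coe, modelWithCornersSelf_coe_symm, Function.id_comp,
    Function.comp_id, Set.preimage_id, Set.range_id, Set.inter_univ] at hx ⊢
  have key : ∀ y ∈ (e.symm ≫ₕ e').source, (e.symm ≫ₕ e') y - y ∈ L := by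
    intro y hy
    rw [← proj_eq_iff]
    have hy' : e.symm y ∈ e'.source := by
      rw [OpenPartialHomeomorph.trans_source] at hy
      exact hy.2
    have h := e'.left_inv hy'
    rw [symm_eq_of_mem_atlas L he'] at h
    change proj L y = proj L (e' (e.symm y))
    rw [h, symm_eq_of_mem_atlas L he]
  obtain ⟨U, hU, hUL⟩ : ∃ U ∈ 𝓝 ((e.symm ≫ₕ e') x - x),
      U ∩ (L : Set (ℂ × ℂ)) ⊆ {(e.symm ≫ₕ e') x - x} :=
    mem_nhdsWithin_iff_exists_mem_nhds_inter.mp (singleton_mem_nhdsWithin_of_mem_discrete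
      (DiscreteTopology.isDiscrete (s := (L : Set (ℂ × ℂ)))) (key x hx))
  have hcont : ContinuousAt (fun y ↦ (e.symm ≫ₕ e') y - y) x :=
    ((e.symm ≫ₕ e').continuousAt hx).sub continuousAt_id
  have hev : ∀ᶠ y in 𝓝 x, (e.symm ≫ₕ e') y = y + ((e.symm ≫ₕ e') x - x) := by
    filter_upwards [hcont hU, (e.symm ≫ₕ e').open_source.mem_nhds hx] with y h1 h2
    have h3 : (e.symm ≫ₕ e') y - y = (e.symm ≫ₕ e') x - x := hUL ⟨h1, key y h2⟩
    rw [← h3]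
    exact (add_sub_cancel _ _).symm
  exact ((contDiffAt_id.add contDiffAt_const).congr_of_eventuallyEq hev).contDiffWithinAt

end ComplexTorus

/-! ### Holomorphic symplectic forms and Lagrangian surfaces -/

section Forms

variable {E H : Type*} [NormedAddCommGroup E] [NormedSpace ℂ E] [TopologicalSpace H]
  {I : ModelWithCorners ℂ E H} {M : Type*} [TopologicalSpace M] [ChartedSpace H M]
  {E' H' : Type*} [NormedAddCommGroup E'] [NormedSpace ℂ E'] [TopologicalSpace H']
  {J : ModelWithCorners ℂ E' H'} {N : Type*} [TopologicalSpace N] [ChartedSpace H' N]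

variable (I M) in
/-- A (not necessarily continuous) field of complex alternating bilinear forms on the tangent
spaces of `M`. -/
abbrev TwoForm : Type _ :=
  ∀ x : M, TangentSpace I x [⋀^Fin 2]→L[ℂ] ℂ

/-- The pullback `f^* η` of a two-form. -/
noncomputable def TwoForm.pullback (η : TwoForm J N) (f : M → N) : TwoForm I M :=
  fun x ↦ (η (f x)).compContinuousLinearMap (mfderiv I J f x)

/-- The expression of a two-form in the coordinates given by the chart around `x₀`. -/
noncomputable def TwoForm.inChart (η : TwoForm I M) (x₀ : M) : E → E [⋀^Fin 2]→L[ℂ] ℂ :=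
  TwoForm.pullback (I := 𝓘(ℂ, E)) η (extChartAt I x₀).symm

/-- Holomorphic symplectic forms on a complex manifold (without boundary): holomorphic, closed and
everywhere nondegenerate two-forms. -/
structure TwoForm.IsSymplectic (η : TwoForm I M) : Prop where
  holomorphic : ∀ x₀ : M, DifferentiableOn ℂ (η.inChart x₀) (extChartAt I x₀).target
  closed : ∀ x₀ : M, ∀ z ∈ (extChartAt I x₀).target, extDeriv (η.inChart x₀) z = 0
  nondegenerate : ∀ (x : M) (v : TangentSpace I x),
    (∀ w : TangentSpace I x, η x ![v, w] = 0) → v = 0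

/-- The two-form `(η, θ) = pr₁^* η + pr₂^* θ` on `M × N`. -/
noncomputable def TwoForm.prod (η : TwoForm I M) (θ : TwoForm J N) :
    TwoForm (I.prod J) (M × N) :=
  η.pullback Prod.fst + θ.pullback Prod.snd

end Forms

section Lagrangian

universe u

variable {E H : Type*} [NormedAddCommGroup E] [NormedSpace ℂ E] [TopologicalSpace H]
  {I : ModelWithCorners ℂ E H} {M : Type u} [TopologicalSpace M] [ChartedSpace H M]

/-- `η` is a holomorphic symplectic form on the complex manifold `M` of dimension `4`, and the
subset `X` of `M` is a smooth Lagrangian surface for `η`: a closed connected complex submanifold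
of dimension `2`, that is the image of a holomorphic embedding `i` of a complex manifold of
dimension `2`, on which the form `η` restricts to zero. -/
def IsLagrangianSurface (η : TwoForm I M) (X : Set M) : Prop :=
  η.IsSymplectic ∧ Module.finrank ℂ E = 4 ∧ IsClosed X ∧ IsConnected X ∧
    ∃ (Y : Type u) (_ : TopologicalSpace Y) (_ : ChartedSpace (ℂ × ℂ) Y)
      (_ : IsManifold 𝓘(ℂ, ℂ × ℂ) ω Y) (i : Y → M),
      Manifold.IsSmoothEmbedding 𝓘(ℂ, ℂ × ℂ) I ω i ∧ Set.range i = X ∧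
        η.pullback i = (0 : TwoForm 𝓘(ℂ, ℂ × ℂ) Y)

end Lagrangian

/-! ### Smooth Kummer surfaces

Let `T = ℂ² / L`.  Near a fixed point `p` of `x ↦ -x`, the blow-up of `T` at `p` has the two
coordinate systems `(u, v)` in which the blow-down map is `(u, v) ↦ p + u (1, v)` and
`(u, v) ↦ p + u (v, 1)`; the exceptional curve is `u = 0`.  The lift of `x ↦ -x` is
`(u, v) ↦ (-u, v)`, so that `(u ^ 2, v)` are coordinates on its quotient. -/

section Kummer

variable {L : Submodule ℤ (ℂ × ℂ)} [DiscreteTopology L]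
  {S : Type*} [TopologicalSpace S] [ChartedSpace (ℂ × ℂ) S]

/-- Let `κ` be a map from the complex torus to `S` (only its values off the fixed points of
`x ↦ -x` matter), let `p` be such a fixed point, and `d v` be `(1, v)` or `(v, 1)`.  The
holomorphic chart `ψ` of `S` is defined around a whole affine line `{0} × ℂ`, and in its
coordinates the map `κ` becomes `p + u • d v ↦ (u ^ 2, v)`. -/
structure IsKummerChart (κ : ComplexTorus L → S) (p : ComplexTorus L) (d : ℂ → ℂ × ℂ)
    (ψ : OpenPartialHomeomorph S (ℂ × ℂ)) : Prop where
  mem_maximalAtlas : ψ ∈ IsManifold.maximalAtlas 𝓘(ℂ, ℂ × ℂ) ω S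
  zero_mem_target : ∀ v : ℂ, ((0 : ℂ), v) ∈ ψ.target
  symm_apply : ∀ u v : ℂ, u ≠ 0 → (u ^ 2, v) ∈ ψ.target →
    ψ.symm (u ^ 2, v) = κ (p + ComplexTorus.proj L (u • d v))

/-- The connected compact complex surface `S` is the smooth Kummer surface of the torus
`T = ℂ² / L`, with quotient map `κ : T ⇢ S`: it is the quotient by (the lift of) `x ↦ -x` of the
blow-up of `T` at the fixed points of `x ↦ -x`.  Off these fixed points, `κ` is the quotient by
`x ↦ -x`, and over each of the nodes that they give in the quotient, `S` is described by the two
standard coordinate systems. -/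
structure IsKummerSurface (κ : ComplexTorus L → S) : Prop where
  isLocalDiffeomorphOn :
    IsLocalDiffeomorphOn 𝓘(ℂ, ℂ × ℂ) 𝓘(ℂ, ℂ × ℂ) ω κ {x : ComplexTorus L | -x ≠ x}
  apply_eq_iff : ∀ x y : ComplexTorus L, -x ≠ x → -y ≠ y → (κ x = κ y ↔ y = x ∨ y = -x)
  exists_chart : ∀ p : ComplexTorus L, -p = p →
    (∃ ψ, IsKummerChart κ p (fun v ↦ (1, v)) ψ) ∧ (∃ ψ, IsKummerChart κ p (fun v ↦ (v, 1)) ψ)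
  exceptional : ∀ y : S, (∀ x : ComplexTorus L, -x ≠ x → κ x ≠ y) →
    ∃ (p : ComplexTorus L) (ψ : OpenPartialHomeomorph S (ℂ × ℂ)), -p = p ∧
      (IsKummerChart κ p (fun v ↦ (1, v)) ψ ∨ IsKummerChart κ p (fun v ↦ (v, 1)) ψ) ∧
      y ∈ ψ.source ∧ (ψ y).1 = 0

end Kummer

/-! The form `(s, -λ s)` pulls back along `x ↦ (f x, x)` to `f^* s - λ s`, so the graph of a
holomorphic self-map `f` is Lagrangian as soon as `f^* s = λ s` and `λ ≠ 0`
(`isLagrangianSurface_graph`). For the torus this relation is the hypothesis. For the Kummer surface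
it remains to find a holomorphic `φ : S → S` whose graph is the closure in question, and to prove
`φ^* s = λ s`.

A lift of `g` to `ℂ²` has `L`-periodic, hence bounded, derivative. By Liouville it is affine, so `g
- g 0` comes from a linear map `A` with `A w ∈ L ↔ w ∈ L`. Evaluating the hypothesis on `dz₁ ∧ dz₂`
gives `det A = λ`.

Since `A` commutes with `-1`, it induces a map off the exceptional curves. In Kummer coordinates
`(w, v) = (u ^ 2, v)` this map is `(w, v) ↦ (w m(v) ^ 2, μ(v))`, which is holomorphic at `w = 0`.
The local extensions agree because the image of `κ` off the fixed points is dense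
(`exists_induced_map`).

A symplectic form `s` pulls back to `C dz₁ ∧ dz₂` on `ℂ²` off the half-lattice points. The
coefficient `C` descends to a holomorphic function on the compact connected `S`, hence is constant
(`exists_coeff_eq`). So `φ^* s = (det A) s` on a dense set, and everywhere by continuity
(`pullback_eq_smul`). -/

theorem IsManifold.trans_mem_maximalAtlas_of_contMDiffOn {𝕜 E H M : Type*}
    [NontriviallyNormedField 𝕜] [NormedAddCommGroup E] [NormedSpace 𝕜 E] [TopologicalSpace H]
    {I : ModelWithCorners 𝕜 E H} [TopologicalSpace M] [ChartedSpace H M] {n : WithTop ℕ∞}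
    [IsManifold I n M] {e : OpenPartialHomeomorph M H} (he : e ∈ IsManifold.maximalAtlas I n M)
    {f : OpenPartialHomeomorph H H} (hf : ContMDiffOn I I n f f.source)
    (hf' : ContMDiffOn I I n f.symm f.target) : e.trans f ∈ IsManifold.maximalAtlas I n M := by
  refine OpenPartialHomeomorph.mem_maximalAtlas_of_contMDiffOn _ ?_ ?_
  · exact ContMDiffOn.comp (t := f.source) hf
      ((contMDiffOn_of_mem_maximalAtlas he).mono fun z hz ↦ hz.1) fun z hz ↦ hz.2
  · exact ContMDiffOn.comp (f := f.symm) (g := e.symm) (t := e.target)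
      (contMDiffOn_symm_of_mem_maximalAtlas he) (hf'.mono fun z hz ↦ hz.1) fun z hz ↦ hz.2

/-! ### Graphs of holomorphic maps are embedded submanifolds -/

section Graph

variable {E H : Type*} [NormedAddCommGroup E] [NormedSpace ℂ E]
  {M : Type*} [TopologicalSpace M] [ChartedSpace E M]
  {E' : Type*} [NormedAddCommGroup E'] [NormedSpace ℂ E']
  {N : Type*} [TopologicalSpace N] [ChartedSpace E' N]

/-- The shear `(a, b) ↦ (a - Φ b, b)` over an open set on which `Φ` is continuous. -/
def shearHomeomorph (Φ : E → E') (V : Set E) (hV : IsOpen V) (hΦ : ContinuousOn Φ V) :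
    OpenPartialHomeomorph (E' × E) (E' × E) where
  toFun z := (z.1 - Φ z.2, z.2)
  invFun z := (z.1 + Φ z.2, z.2)
  source := Set.univ ×ˢ V
  target := Set.univ ×ˢ V
  map_source' z hz := ⟨trivial, hz.2⟩
  map_target' z hz := ⟨trivial, hz.2⟩
  left_inv' z _ := by simp
  right_inv' z _ := by simp
  open_source := isOpen_univ.prod hV
  open_target := isOpen_univ.prod hV
  continuousOn_toFun := (continuousOn_fst.sub
    (hΦ.comp continuousOn_snd fun _ h ↦ h.2)).prodMk continuousOn_snd
  continuousOn_invFun := (continuousOn_fst.add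
    (hΦ.comp continuousOn_snd fun _ h ↦ h.2)).prodMk continuousOn_snd

variable [IsManifold 𝓘(ℂ, E) ω M] [IsManifold 𝓘(ℂ, E') ω N]

/-- Shearing the product chart by the local expression of `f` straightens the graph to `b ↦ (0, b)`,
which is the normal form of an immersion after swapping the factors. -/
theorem ContMDiff.isImmersion_graph {f : M → N} (hf : ContMDiff 𝓘(ℂ, E) 𝓘(ℂ, E') ω f) :
    Manifold.IsImmersion 𝓘(ℂ, E) (𝓘(ℂ, E').prod 𝓘(ℂ, E)) ω (fun x ↦ (f x, x)) := by
  apply Manifold.IsImmersionOfComplement.isImmersion (F := E')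
  intro x
  set c := chartAt E' (f x) with hc
  set d := chartAt E x with hd
  have hcA : c ∈ IsManifold.maximalAtlas 𝓘(ℂ, E') ω N := IsManifold.chart_mem_maximalAtlas _
  have hdA : d ∈ IsManifold.maximalAtlas 𝓘(ℂ, E) ω M := IsManifold.chart_mem_maximalAtlas _
  set V : Set E := d.target ∩ d.symm ⁻¹' (f ⁻¹' c.source) with hVdef
  have hV : IsOpen V :=
    d.isOpen_inter_preimage_symm (c.open_source.preimage hf.continuous)
  have hsm : ContMDiffOn 𝓘(ℂ, E) 𝓘(ℂ, E') ω (fun b ↦ c (f (d.symm b))) V := by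
    refine (contMDiffOn_of_mem_maximalAtlas hcA).comp (hf.comp_contMDiffOn
      ((contMDiffOn_symm_of_mem_maximalAtlas hdA).mono fun b hb ↦ hb.1)) fun b hb ↦ hb.2
  set sh := shearHomeomorph (fun b ↦ c (f (d.symm b))) V hV hsm.continuousOn
  have hprod : c.prod d ∈ IsManifold.maximalAtlas (𝓘(ℂ, E').prod 𝓘(ℂ, E)) ω (N × M) :=
    IsManifold.mem_maximalAtlas_prod hcA hdA
  have hsm' : ContMDiffOn (𝓘(ℂ, E').prod 𝓘(ℂ, E)) 𝓘(ℂ, E') ω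
      (fun z : E' × E ↦ c (f (d.symm z.2))) (Set.univ ×ˢ V) :=
    hsm.comp contMDiffOn_snd fun _ h ↦ h.2
  have hshc : ContMDiffOn (𝓘(ℂ, E').prod 𝓘(ℂ, E)) (𝓘(ℂ, E').prod 𝓘(ℂ, E)) ω sh sh.source :=
    (contMDiffOn_fst.sub hsm').prodMk contMDiffOn_snd
  have hshc' : ContMDiffOn (𝓘(ℂ, E').prod 𝓘(ℂ, E)) (𝓘(ℂ, E').prod 𝓘(ℂ, E)) ω sh.symm sh.target :=
    (contMDiffOn_fst.add hsm').prodMk contMDiffOn_snd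
  have hcod : (c.prod d).trans sh ∈
      IsManifold.maximalAtlas (𝓘(ℂ, E').prod 𝓘(ℂ, E)) ω (N × M) := by
    rw [chartedSpaceSelf_prod] at hshc hshc'
    exact IsManifold.trans_mem_maximalAtlas_of_contMDiffOn hprod hshc hshc'
  have hfc : ContinuousAt (fun x ↦ (f x, x)) x := by
    have := hf.continuous
    fun_prop
  refine Manifold.IsImmersionAtOfComplement.mk_of_continuousAt hfc
    (ContinuousLinearEquiv.prodComm ℂ E E') (d.restr (f ⁻¹' c.source)) ((c.prod d).trans sh) ?_ ?_
    (restr_mem_maximalAtlas _ hdA (c.open_source.preimage hf.continuous)) hcod ?_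
  · rw [OpenPartialHomeomorph.restr_source' _ _ (c.open_source.preimage hf.continuous)]
    exact ⟨mem_chart_source _ _, mem_chart_source _ _⟩
  · refine ⟨⟨mem_chart_source _ _, mem_chart_source _ _⟩, trivial, ?_⟩
    change d x ∈ V
    refine ⟨mem_chart_target _ _, ?_⟩
    change f (d.symm (d x)) ∈ c.source
    rw [d.left_inv (mem_chart_source _ _)]
    exact mem_chart_source _ _
  · intro b hb
    have hb' : b ∈ d.target := by
      simp at hb
      exact hb.1
    change (c (f (d.symm b)) - c (f (d.symm (d (d.symm b)))), d (d.symm b)) = (0, b)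
    rw [d.right_inv hb', sub_self]

theorem ContMDiff.isSmoothEmbedding_graph {f : M → N} (hf : ContMDiff 𝓘(ℂ, E) 𝓘(ℂ, E') ω f) :
    Manifold.IsSmoothEmbedding 𝓘(ℂ, E) (𝓘(ℂ, E').prod 𝓘(ℂ, E)) ω (fun x ↦ (f x, x)) := by
  refine ⟨hf.isImmersion_graph, ?_⟩
  exact Topology.IsEmbedding.of_leftInverse (f := Prod.snd) (fun _ ↦ rfl) continuous_snd
    (hf.continuous.prodMk continuous_id)

end Graph

/-! ### Pullbacks and products of two-forms -/

namespace TwoForm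

section Pullback

variable {E H : Type*} [NormedAddCommGroup E] [NormedSpace ℂ E] [TopologicalSpace H]
  {I : ModelWithCorners ℂ E H} {M : Type*} [TopologicalSpace M] [ChartedSpace H M]
  {E' H' : Type*} [NormedAddCommGroup E'] [NormedSpace ℂ E'] [TopologicalSpace H']
  {J : ModelWithCorners ℂ E' H'} {N : Type*} [TopologicalSpace N] [ChartedSpace H' N]
  {E'' H'' : Type*} [NormedAddCommGroup E''] [NormedSpace ℂ E''] [TopologicalSpace H'']
  {K : ModelWithCorners ℂ E'' H''} {P : Type*} [TopologicalSpace P] [ChartedSpace H'' P]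

theorem pullback_apply (η : TwoForm J N) (f : M → N) (x : M) (v w : TangentSpace I x) :
    (η.pullback f : TwoForm I M) x ![v, w] =
      η (f x) ![mfderiv I J f x v, mfderiv I J f x w] := by
  unfold TwoForm.pullback
  rw [ContinuousAlternatingMap.compContinuousLinearMap_apply]
  congr 1
  ext i
  fin_cases i <;> rfl

theorem pullback_comp (η : TwoForm K P) {g : N → P} {f : M → N} {x : M}
    (hg : MDifferentiableAt J K g (f x)) (hf : MDifferentiableAt I J f x) :
    (η.pullback (g ∘ f) : TwoForm I M) x =
      ((η.pullback g : TwoForm J N) (f x)).compContinuousLinearMap (mfderiv I J f x) := by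
  unfold TwoForm.pullback
  rw [mfderiv_comp x hg hf]
  rfl

theorem pullback_congr (η : TwoForm J N) {f g : M → N} {x : M} (h : f =ᶠ[𝓝 x] g) :
    (η.pullback f : TwoForm I M) x = (η.pullback g : TwoForm I M) x := by
  unfold TwoForm.pullback
  rw [h.mfderiv_eq]
  let η' : N → E' [⋀^Fin 2]→L[ℂ] ℂ := η
  let D : E →L[ℂ] E' := mfderiv I J g x
  change (η' (f x)).compContinuousLinearMap D = (η' (g x)).compContinuousLinearMap D
  rw [h.self_of_nhds]

theorem pullback_id (η : TwoForm I M) : η.pullback (fun x : M ↦ x) = η := by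
  ext1 x
  unfold TwoForm.pullback
  change (η x).compContinuousLinearMap (mfderiv I I id x) = _
  rw [mfderiv_id]
  rfl

theorem pullback_add (η θ : TwoForm J N) (f : M → N) :
    ((η + θ).pullback f : TwoForm I M) = η.pullback f + θ.pullback f := rfl

theorem inChart_smul (c : ℂ) (η : TwoForm I M) (x₀ : M) :
    (c • η).inChart x₀ = c • η.inChart x₀ := rfl

theorem IsSymplectic.const_smul {η : TwoForm I M} (hη : η.IsSymplectic) {c : ℂ} (hc : c ≠ 0) :
    (c • η).IsSymplectic where
  holomorphic x₀ := by
    rw [inChart_smul]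
    exact (hη.holomorphic x₀).const_smul c
  closed x₀ z hz := by
    rw [inChart_smul, extDeriv_smul, hη.closed x₀ z hz, smul_zero]
  nondegenerate x v hv := by
    refine hη.nondegenerate x v fun w ↦ ?_
    have := hv w
    exact (smul_eq_zero_iff_right hc).mp this

end Pullback

section Prod

variable {E : Type*} [NormedAddCommGroup E] [NormedSpace ℂ E]
  {M : Type*} [TopologicalSpace M] [ChartedSpace E M] [IsManifold 𝓘(ℂ, E) ω M]
  {E' : Type*} [NormedAddCommGroup E'] [NormedSpace ℂ E']
  {N : Type*} [TopologicalSpace N] [ChartedSpace E' N] [IsManifold 𝓘(ℂ, E') ω N]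

theorem mdifferentiableAt_extChartAt_symm (x₀ : M) {z : E}
    (hz : z ∈ (extChartAt 𝓘(ℂ, E) x₀).target) :
    MDifferentiableAt 𝓘(ℂ, E) 𝓘(ℂ, E) (extChartAt 𝓘(ℂ, E) x₀).symm z :=
  ((contMDiffOn_extChartAt_symm (n := ω) x₀).contMDiffAt
    ((isOpen_extChartAt_target x₀).mem_nhds hz)).mdifferentiableAt (by simp)

theorem inChart_prod (η : TwoForm 𝓘(ℂ, E) M) (θ : TwoForm 𝓘(ℂ, E') N) (x₀ : M) (y₀ : N)
    {z : E × E'} (hz : z ∈ (extChartAt (𝓘(ℂ, E).prod 𝓘(ℂ, E')) (x₀, y₀)).target) :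
    (η.prod θ).inChart (x₀, y₀) z =
      (η.inChart x₀ z.1).compContinuousLinearMap (ContinuousLinearMap.fst ℂ E E') +
      (θ.inChart y₀ z.2).compContinuousLinearMap (ContinuousLinearMap.snd ℂ E E') := by
  rw [extChartAt_prod] at hz
  have h1 := mdifferentiableAt_extChartAt_symm x₀ hz.1
  have h2 := mdifferentiableAt_extChartAt_symm y₀ hz.2
  have e : ⇑(extChartAt (𝓘(ℂ, E).prod 𝓘(ℂ, E')) (x₀, y₀)).symm =
      fun z : E × E' ↦ ((extChartAt 𝓘(ℂ, E) x₀).symm z.1, (extChartAt 𝓘(ℂ, E') y₀).symm z.2) := by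
    rw [extChartAt_prod]
    rfl
  have hd : MDifferentiableAt 𝓘(ℂ, E × E') (𝓘(ℂ, E).prod 𝓘(ℂ, E'))
      (fun z : E × E' ↦ ((extChartAt 𝓘(ℂ, E) x₀).symm z.1, (extChartAt 𝓘(ℂ, E') y₀).symm z.2)) z :=
    (h1.comp z (mdifferentiableAt_iff_differentiableAt.mpr differentiableAt_fst)).prodMk
      (h2.comp z (mdifferentiableAt_iff_differentiableAt.mpr differentiableAt_snd))
  unfold TwoForm.inChart
  rw [e, TwoForm.prod, pullback_add]
  change (TwoForm.pullback _ _ : TwoForm 𝓘(ℂ, E × E') (E × E')) z +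
    (TwoForm.pullback _ _ : TwoForm 𝓘(ℂ, E × E') (E × E')) z = _
  congr 1
  · refine (pullback_comp (I := 𝓘(ℂ, E × E')) (J := 𝓘(ℂ, E).prod 𝓘(ℂ, E')) (x := z) η
      (g := Prod.fst) mdifferentiableAt_fst hd).symm.trans ?_
    refine (pullback_comp (I := 𝓘(ℂ, E × E')) (f := Prod.fst) η h1
      (mdifferentiableAt_iff_differentiableAt.mpr differentiableAt_fst)).trans ?_
    rw [mfderiv_eq_fderiv, fderiv_fst]
    rfl
  · refine (pullback_comp (I := 𝓘(ℂ, E × E')) (J := 𝓘(ℂ, E).prod 𝓘(ℂ, E')) (x := z) θ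
      (g := Prod.snd) mdifferentiableAt_snd hd).symm.trans ?_
    refine (pullback_comp (I := 𝓘(ℂ, E × E')) (f := Prod.snd) θ h2
      (mdifferentiableAt_iff_differentiableAt.mpr differentiableAt_snd)).trans ?_
    rw [mfderiv_eq_fderiv, fderiv_snd]
    rfl

/-- In product charts the form is a sum of pullbacks along the projections, and `extDeriv` commutes
with pullback. Nondegeneracy is tested against `(w, 0)` and `(0, w)` separately. -/
theorem IsSymplectic.prod {η : TwoForm 𝓘(ℂ, E) M} {θ : TwoForm 𝓘(ℂ, E') N}
    (hη : η.IsSymplectic) (hθ : θ.IsSymplectic) : (η.prod θ).IsSymplectic := by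
  have key : ∀ (x₀ : M) (y₀ : N), ∀ z ∈ (extChartAt (𝓘(ℂ, E).prod 𝓘(ℂ, E')) (x₀, y₀)).target,
      (η.prod θ).inChart (x₀, y₀) =ᶠ[𝓝 z] fun z ↦
      (η.inChart x₀ z.1).compContinuousLinearMap (ContinuousLinearMap.fst ℂ E E') +
      (θ.inChart y₀ z.2).compContinuousLinearMap (ContinuousLinearMap.snd ℂ E E') := by
    intro x₀ y₀ z hz
    filter_upwards [(isOpen_extChartAt_target (x₀, y₀)).mem_nhds hz] with w hw
    exact inChart_prod η θ x₀ y₀ hw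
  have hd1 : ∀ (x₀ : M) (y₀ : N), ∀ z ∈ (extChartAt (𝓘(ℂ, E).prod 𝓘(ℂ, E')) (x₀, y₀)).target,
      DifferentiableAt ℂ (η.inChart x₀) z.1 := by
    intro x₀ y₀ z hz
    rw [extChartAt_prod] at hz
    exact (hη.holomorphic x₀).differentiableAt ((isOpen_extChartAt_target x₀).mem_nhds hz.1)
  have hd2 : ∀ (x₀ : M) (y₀ : N), ∀ z ∈ (extChartAt (𝓘(ℂ, E).prod 𝓘(ℂ, E')) (x₀, y₀)).target,
      DifferentiableAt ℂ (θ.inChart y₀) z.2 := by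
    intro x₀ y₀ z hz
    rw [extChartAt_prod] at hz
    exact (hθ.holomorphic y₀).differentiableAt ((isOpen_extChartAt_target y₀).mem_nhds hz.2)
  have hc1 : ∀ (x₀ : M) (y₀ : N), ∀ z ∈ (extChartAt (𝓘(ℂ, E).prod 𝓘(ℂ, E')) (x₀, y₀)).target,
      DifferentiableAt ℂ (fun z : E × E' ↦ (η.inChart x₀ z.1).compContinuousLinearMap
        (ContinuousLinearMap.fst ℂ E E')) z := fun x₀ y₀ z hz ↦
    ((hd1 x₀ y₀ z hz).comp z
      differentiableAt_fst).continuousAlternatingMapCompContinuousLinearMap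
        (differentiableAt_const _)
  have hc2 : ∀ (x₀ : M) (y₀ : N), ∀ z ∈ (extChartAt (𝓘(ℂ, E).prod 𝓘(ℂ, E')) (x₀, y₀)).target,
      DifferentiableAt ℂ (fun z : E × E' ↦ (θ.inChart y₀ z.2).compContinuousLinearMap
        (ContinuousLinearMap.snd ℂ E E')) z := fun x₀ y₀ z hz ↦
    ((hd2 x₀ y₀ z hz).comp z
      differentiableAt_snd).continuousAlternatingMapCompContinuousLinearMap
        (differentiableAt_const _)
  refine ⟨?_, ?_, ?_⟩
  · rintro ⟨x₀, y₀⟩ z hz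
    exact (((hc1 x₀ y₀ z hz).add (hc2 x₀ y₀ z hz)).congr_of_eventuallyEq
      (key x₀ y₀ z hz)).differentiableWithinAt
  · rintro ⟨x₀, y₀⟩ z hz
    rw [(key x₀ y₀ z hz).extDeriv_eq, extDeriv_fun_add (hc1 x₀ y₀ z hz) (hc2 x₀ y₀ z hz)]
    have e1 := extDeriv_pullback (r := ω) (hd1 x₀ y₀ z hz)
      (contDiff_fst (𝕜 := ℂ) (E := E) (F := E')).contDiffAt (by simp)
    have e2 := extDeriv_pullback (r := ω) (hd2 x₀ y₀ z hz)
      (contDiff_snd (𝕜 := ℂ) (E := E) (F := E')).contDiffAt (by simp)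
    simp only [fderiv_fst, fderiv_snd] at e1 e2
    rw [e1, e2]
    rw [extChartAt_prod] at hz
    rw [hη.closed x₀ _ hz.1, hθ.closed y₀ _ hz.2]
    ext v
    simp
  · rintro ⟨x, y⟩ ⟨v₁, v₂⟩ hv
    have hval : ∀ (w₁ : TangentSpace 𝓘(ℂ, E) x) (w₂ : TangentSpace 𝓘(ℂ, E') y),
        η x ![v₁, w₁] + θ y ![v₂, w₂] = 0 := by
      intro w₁ w₂
      refine Eq.trans ?_ (hv (w₁, w₂))
      refine Eq.symm ((congrArg₂ (· + ·) (pullback_apply η Prod.fst (x, y) _ _)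
        (pullback_apply θ Prod.snd (x, y) _ _)).trans ?_)
      rw [mfderiv_fst, mfderiv_snd]
      rfl
    have h1 : v₁ = 0 := hη.nondegenerate x v₁ fun w ↦ by
      have := hval w 0
      rwa [(θ y).map_coord_zero (m := ![v₂, 0]) 1 rfl, add_zero] at this
    have h2 : v₂ = 0 := hθ.nondegenerate y v₂ fun w ↦ by
      have := hval 0 w
      rwa [(η x).map_coord_zero (m := ![v₁, 0]) 1 rfl, zero_add] at this
    rw [h1, h2]
    rfl

end Prod

end TwoForm

/-! ### The Lagrangian criterion for graphs -/

section Lagrangian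

universe u

/-- The graph of a holomorphic self-map `f` with `f^* s = c s` is a Lagrangian surface for
`(s, -c s)`. -/
theorem isLagrangianSurface_graph {M : Type u} [TopologicalSpace M] [T2Space M] [ConnectedSpace M]
    [ChartedSpace (ℂ × ℂ) M] [IsManifold 𝓘(ℂ, ℂ × ℂ) ω M] {f : M → M}
    (hf : ContMDiff 𝓘(ℂ, ℂ × ℂ) 𝓘(ℂ, ℂ × ℂ) ω f) {c : ℂ} (hc : c ≠ 0)
    {s : TwoForm 𝓘(ℂ, ℂ × ℂ) M} (hs : s.IsSymplectic) (hfs : s.pullback f = c • s) :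
    IsLagrangianSurface (s.prod (-c • s)) {y : M × M | y.1 = f y.2} := by
  have hrange : Set.range (fun x ↦ (f x, x)) = {y : M × M | y.1 = f y.2} := by
    ext ⟨a, b⟩
    constructor
    · rintro ⟨x, hx⟩
      simp only [Prod.mk.injEq] at hx
      simp [← hx.1, ← hx.2]
    · intro h
      exact ⟨b, Prod.ext h.symm rfl⟩
  have hcont : Continuous (fun x ↦ (f x, x)) := hf.continuous.prodMk continuous_id
  refine ⟨hs.prod (hs.const_smul (neg_ne_zero.mpr hc)), ?_, ?_, ?_, M, inferInstance, inferInstance,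
    inferInstance, fun x ↦ (f x, x), hf.isSmoothEmbedding_graph, hrange, ?_⟩
  · simp [Module.finrank_prod]
  · exact isClosed_eq continuous_fst (hf.continuous.comp continuous_snd)
  · rw [← hrange]
    exact isConnected_range hcont
  · ext1 x
    have hfx : MDifferentiableAt 𝓘(ℂ, ℂ × ℂ) 𝓘(ℂ, ℂ × ℂ) f x :=
      (hf x).mdifferentiableAt (by simp)
    have hi : MDifferentiableAt 𝓘(ℂ, ℂ × ℂ) (𝓘(ℂ, ℂ × ℂ).prod 𝓘(ℂ, ℂ × ℂ)) (fun x ↦ (f x, x)) x :=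
      hfx.prodMk mdifferentiableAt_id
    have h1 := TwoForm.pullback_comp (x := x) s (g := Prod.fst) mdifferentiableAt_fst hi
    have h2 := TwoForm.pullback_comp (x := x) (-c • s) (g := Prod.snd) mdifferentiableAt_snd hi
    -- The two summands pull back to `f^* s` and `-c s`, which cancel.
    refine (congrArg₂ (· + ·) h1 h2).symm.trans ?_
    have e1 : Prod.fst ∘ (fun x ↦ (f x, x)) = f := rfl
    have e2 : Prod.snd ∘ (fun x ↦ (f x, x)) = fun x ↦ x := rfl
    rw [e1, e2, hfs, TwoForm.pullback_id]
    ext v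
    change c * s x v + -c * s x v = 0
    ring

end Lagrangian

/-! ### Alternating forms on `ℂ²` -/

/-- The constant two-form `dz₁ ∧ dz₂` on `ℂ²`. -/
noncomputable def detForm : (ℂ × ℂ) [⋀^Fin 2]→L[ℂ] ℂ where
  toFun v := (v 0).1 * (v 1).2 - (v 0).2 * (v 1).1
  map_update_add' v i x y := by
    fin_cases i <;> simp <;> ring
  map_update_smul' v i c x := by
    fin_cases i <;> simp <;> ring
  map_eq_zero_of_eq' v i j h hij := by
    fin_cases i <;> fin_cases j <;> simp_all <;> ring
  cont := by fun_prop

theorem detForm_apply (v w : ℂ × ℂ) : detForm ![v, w] = v.1 * w.2 - v.2 * w.1 := rfl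

/-- Alternating bilinear forms on `ℂ²` form a line, so in coordinates a two-form on a surface is a
single scalar function. -/
theorem apply_eq_mul_detForm (η : (ℂ × ℂ) [⋀^Fin 2]→L[ℂ] ℂ) (v w : ℂ × ℂ) :
    η ![v, w] = η ![(1, 0), (0, 1)] * detForm ![v, w] := by
  have hadd : ∀ a b c, η ![a + b, c] = η ![a, c] + η ![b, c] := fun a b c ↦
    η.toMultilinearMap.cons_add ![c] a b
  have hsmul : ∀ (t : ℂ) a c, η ![t • a, c] = t * η ![a, c] := fun t a c ↦
    η.toMultilinearMap.cons_smul ![c] t a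
  have hswap : ∀ a b, η ![a, b] = -η ![b, a] := by
    intro a b
    have h := η.toAlternatingMap.map_swap ![b, a] (i := 0) (j := 1) (by simp)
    have e : ![b, a] ∘ Equiv.swap (0 : Fin 2) 1 = ![a, b] := by
      ext i <;> fin_cases i <;> simp
    rw [e] at h
    exact h
  have hself : ∀ a, η ![a, a] = 0 := fun a ↦
    η.map_eq_zero_of_eq ![a, a] (i := 0) (j := 1) rfl (by simp)
  have hdec : ∀ a : ℂ × ℂ, a = a.1 • ((1 : ℂ), (0 : ℂ)) + a.2 • ((0 : ℂ), (1 : ℂ)) := by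
    intro a
    ext <;> simp
  rw [detForm_apply, hdec v, hadd, hsmul, hsmul, hswap _ w, hswap _ w, hdec w]
  simp only [hadd, hsmul, hself]
  rw [hswap (0, 1) (1, 0)]
  simp
  ring

/-! ### Holomorphic self-maps of tori are affine -/

namespace ComplexTorus

variable (L : Submodule ℤ (ℂ × ℂ)) [DiscreteTopology L]

theorem isCoveringMap_proj : IsCoveringMap (proj L) :=
  (AddSubgroup.isAddQuotientCoveringMap_of_comm L.toAddSubgroup
    (DiscreteTopology.isDiscrete (s := (L : Set (ℂ × ℂ))))).isCoveringMap

theorem continuous_proj : Continuous (proj L) := (isCoveringMap_proj L).continuous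

variable {L}

theorem eventually_eq_of_eventually_mem {X : Type*} [TopologicalSpace X] {h : X → ℂ × ℂ} {x : X}
    (hc : ContinuousAt h x) (hL : ∀ᶠ y in 𝓝 x, h y ∈ L) : ∀ᶠ y in 𝓝 x, h y = h x := by
  obtain ⟨U, hU, hUL⟩ : ∃ U ∈ 𝓝 (h x), U ∩ (L : Set (ℂ × ℂ)) ⊆ {h x} :=
    mem_nhdsWithin_iff_exists_mem_nhds_inter.mp (singleton_mem_nhdsWithin_of_mem_discrete
      (DiscreteTopology.isDiscrete (s := (L : Set (ℂ × ℂ)))) hL.self_of_nhds)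
  filter_upwards [hc hU, hL] with y h1 h2
  exact hUL ⟨h1, h2⟩

/-- Since `e` inverts `proj L`, the difference `e (proj L z) - z` lies in the discrete group `L` and
is locally constant. Thus `proj L` is a translation in charts, with identity differential. -/
theorem eventually_chart_proj {e : OpenPartialHomeomorph (ComplexTorus L) (ℂ × ℂ)}
    (he : e ∈ atlas (ℂ × ℂ) (ComplexTorus L)) {z₀ : ℂ × ℂ} (hz₀ : proj L z₀ ∈ e.source) :
    ∀ᶠ z in 𝓝 z₀, e (proj L z) = z + (e (proj L z₀) - z₀) := by
  have hc : ContinuousAt (fun z ↦ e (proj L z) - z) z₀ :=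
    ((e.continuousAt hz₀).comp (continuous_proj L).continuousAt).sub continuousAt_id
  have hmem : ∀ᶠ z in 𝓝 z₀, e (proj L z) - z ∈ L := by
    filter_upwards [(continuous_proj L).continuousAt (e.open_source.mem_nhds hz₀)] with z hz
    have h := e.left_inv hz
    rw [symm_eq_of_mem_atlas L he] at h
    rw [← proj_eq_iff, h]
  filter_upwards [eventually_eq_of_eventually_mem hc hmem] with z hz
  rw [← hz]
  abel

theorem contMDiff_proj : ContMDiff 𝓘(ℂ, ℂ × ℂ) 𝓘(ℂ, ℂ × ℂ) ω (proj L) := by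
  intro z₀
  rw [contMDiffAt_iff]
  refine ⟨(continuous_proj L).continuousAt, ?_⟩
  have h := eventually_chart_proj (chart_mem_atlas (ℂ × ℂ) (proj L z₀)) (mem_chart_source _ _)
  simp only [mfld_simps]
  rw [contDiffWithinAt_univ]
  exact (contDiffAt_id.add contDiffAt_const).congr_of_eventuallyEq h

theorem hasMFDerivAt_proj (z₀ : ℂ × ℂ) :
    HasMFDerivAt 𝓘(ℂ, ℂ × ℂ) 𝓘(ℂ, ℂ × ℂ) (proj L) z₀ (ContinuousLinearMap.id ℂ (ℂ × ℂ)) := by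
  refine ⟨(continuous_proj L).continuousAt, ?_⟩
  have h := eventually_chart_proj (chart_mem_atlas (ℂ × ℂ) (proj L z₀)) (mem_chart_source _ _)
  simp only [mfld_simps, writtenInExtChartAt]
  refine HasFDerivAt.hasFDerivWithinAt ?_
  exact ((hasFDerivAt_id (𝕜 := ℂ) z₀).add_const
    (chartAt (ℂ × ℂ) (proj L z₀) (proj L z₀) - z₀)).congr_of_eventuallyEq h

theorem mfderiv_proj (z : ℂ × ℂ) : mfderiv 𝓘(ℂ, ℂ × ℂ) 𝓘(ℂ, ℂ × ℂ) (proj L) z =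
    ContinuousLinearMap.id ℂ (ℂ × ℂ) :=
  (hasMFDerivAt_proj z).mfderiv

variable (L) in
/-- The symplectic form `dz₁ ∧ dz₂` on `ℂ² / L`. -/
noncomputable def standardForm : TwoForm 𝓘(ℂ, ℂ × ℂ) (ComplexTorus L) := fun _ ↦ detForm

theorem inChart_standardForm (x₀ : ComplexTorus L) :
    (standardForm L).inChart x₀ = fun _ ↦ detForm := by
  funext z
  have h : ⇑(extChartAt 𝓘(ℂ, ℂ × ℂ) x₀).symm = proj L := by
    rw [← symm_eq_of_mem_atlas L (chart_mem_atlas _ x₀)]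
    simp only [mfld_simps]
  unfold TwoForm.inChart TwoForm.pullback
  rw [h, mfderiv_proj]
  rfl

theorem isSymplectic_standardForm : (standardForm L).IsSymplectic where
  holomorphic x₀ := by
    rw [inChart_standardForm]
    exact differentiableOn_const _
  closed x₀ z _ := by
    rw [inChart_standardForm]
    simp only [extDeriv, fderiv_fun_const, Pi.zero_apply]
    exact map_zero (ContinuousAlternatingMap.alternatizeUncurryFinCLM ℂ (ℂ × ℂ) ℂ)
  nondegenerate x v hv := by
    have h1 : v.1 * 1 - v.2 * 0 = 0 := hv ((0, 1) : ℂ × ℂ)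
    have h2 : v.1 * 0 - v.2 * 1 = 0 := hv ((1, 0) : ℂ × ℂ)
    refine Prod.ext ?_ ?_
    · change v.1 = 0
      linear_combination h1
    · change v.2 = 0
      linear_combination -h2

/-- A holomorphic self-map of a torus lifts to a holomorphic map of `ℂ²`. -/
theorem exists_lift {g : ComplexTorus L → ComplexTorus L}
    (hg : ContMDiff 𝓘(ℂ, ℂ × ℂ) 𝓘(ℂ, ℂ × ℂ) ω g) :
    ∃ G : ℂ × ℂ → ℂ × ℂ, ContDiff ℂ ω G ∧ ∀ z, proj L (G z) = g (proj L z) := by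
  obtain ⟨w₀, hw₀⟩ := surjective_proj L (g (proj L 0))
  obtain ⟨G, ⟨-, hG⟩, -⟩ := (isCoveringMap_proj L).existsUnique_continuousMap_lifts
    ⟨g ∘ proj L, hg.continuous.comp (continuous_proj L)⟩ 0 w₀ hw₀
  have hG' : ∀ z, proj L (G z) = g (proj L z) := fun z ↦ congrFun hG z
  refine ⟨G, contDiff_iff_contDiffAt.mpr fun z₀ ↦ ?_, hG'⟩
  -- Near `z₀` the continuous lift is a translate of `e ∘ g ∘ proj L`, so it inherits holomorphy.
  set e := chartAt (ℂ × ℂ) (proj L (G z₀)) with he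
  have h := G.continuous.continuousAt.eventually
    (eventually_chart_proj (chart_mem_atlas (ℂ × ℂ) (proj L (G z₀))) (mem_chart_source _ _))
  have h1 : ContMDiffAt 𝓘(ℂ, ℂ × ℂ) 𝓘(ℂ, ℂ × ℂ) ω (fun z ↦ e (g (proj L z))) z₀ := by
    refine (contMDiffAt_of_mem_maximalAtlas (n := ω) (I := 𝓘(ℂ, ℂ × ℂ))
      (IsManifold.chart_mem_maximalAtlas (proj L (G z₀))) ?_).comp z₀
        ((hg _).comp z₀ (contMDiff_proj z₀))
    rw [← hG']
    exact mem_chart_source _ _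
  refine (h1.contDiffAt.sub
    (contDiffAt_const (c := e (proj L (G z₀)) - G z₀))).congr_of_eventuallyEq ?_
  filter_upwards [h] with z hz
  rw [← hG', hz]
  abel

/-- A holomorphic self-map of a torus is affine. -/
theorem exists_affine [IsZLattice ℝ L] {g : ComplexTorus L → ComplexTorus L}
    (hg : ContMDiff 𝓘(ℂ, ℂ × ℂ) 𝓘(ℂ, ℂ × ℂ) ω g) :
    ∃ A : (ℂ × ℂ) →L[ℂ] (ℂ × ℂ), (∀ z, g (proj L z) = proj L (A z) + g 0) ∧
      ∀ z, mfderiv 𝓘(ℂ, ℂ × ℂ) 𝓘(ℂ, ℂ × ℂ) g (proj L z) = A := by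
  obtain ⟨G, hG, hGg⟩ := exists_lift hg
  have hGd : Differentiable ℂ G := hG.differentiable (by simp)
  have hG' : ContDiff ℂ ω (fderiv ℂ G) := hG.fderiv_right (by simp)
  -- The difference `G (w + l) - G w` takes values in `L`, so it is locally constant in `w`.
  have hper : ∀ z l, l ∈ L → fderiv ℂ G (z + l) = fderiv ℂ G z := by
    intro z l hl
    have h1 : ∀ᶠ w in 𝓝 z, G (w + l) - G w = G (z + l) - G z := by
      refine eventually_eq_of_eventually_mem (L := L) (h := fun w ↦ G (w + l) - G w) ?_ ?_
      · have := hG.continuous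
        fun_prop
      · refine Filter.Eventually.of_forall fun w ↦ ?_
        rw [← proj_eq_iff, hGg, hGg]
        congr 1
        rw [proj_eq_iff]
        simpa using hl
    have h2 : fderiv ℂ (fun w ↦ G (w + l) - G w) z = 0 := by
      rw [Filter.EventuallyEq.fderiv_eq (f := fun _ ↦ G (z + l) - G z) h1]
      simp
    rw [fderiv_fun_sub (by fun_prop) (by fun_prop), fderiv_comp_add_right, sub_eq_zero] at h2
    exact h2
  -- Periodicity under the full lattice bounds the derivative; Liouville's theorem applies.
  have hconst : ∀ z, fderiv ℂ G z = fderiv ℂ G 0 := fun z ↦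
    (hG'.differentiable (by simp)).apply_eq_apply_of_bounded
      (IsZLattice.isCompact_range_of_periodic L _ hG'.continuous hper).isBounded z 0
  set A := fderiv ℂ G 0 with hA
  have haff : ∀ z, G z = A z + G 0 := by
    intro z
    have hd : ∀ w, fderiv ℂ (fun w ↦ G w - A w) w = 0 := by
      intro w
      rw [fderiv_fun_sub (by fun_prop) (by fun_prop), ContinuousLinearMap.fderiv, hconst, sub_self]
    have := is_const_of_fderiv_eq_zero (𝕜 := ℂ) (f := fun w ↦ G w - A w) (by fun_prop) hd z 0
    simp only [map_zero, sub_zero] at this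
    rw [← this]
    abel
  refine ⟨A, fun z ↦ ?_, fun z ↦ ?_⟩
  · have h0 : g 0 = proj L (G 0) := (hGg 0).symm
    rw [← hGg, haff, h0]
    rfl
  · have hgz : MDifferentiableAt 𝓘(ℂ, ℂ × ℂ) 𝓘(ℂ, ℂ × ℂ) g (proj L z) :=
      (hg _).mdifferentiableAt (by simp)
    have h1 := hgz.hasMFDerivAt.comp z (hasMFDerivAt_proj z)
    have h2 := (hasMFDerivAt_proj (L := L) (G z)).comp z (hGd z).hasFDerivAt.hasMFDerivAt
    have e : g ∘ proj L = proj L ∘ G := funext fun z ↦ (hGg z).symm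
    rw [e] at h1
    have := hasMFDerivAt_unique h1 h2
    rw [hconst] at this
    exact this

end ComplexTorus

/-! ### Coefficients of two-forms along maps from `ℂ²` -/

namespace TwoForm

variable {S : Type*} [TopologicalSpace S] [ChartedSpace (ℂ × ℂ) S]

/-- The coefficient of the pullback of a two-form along a map from `ℂ²`. -/
noncomputable def coeff (s : TwoForm 𝓘(ℂ, ℂ × ℂ) S) (G : ℂ × ℂ → S) (z : ℂ × ℂ) : ℂ :=
  (s.pullback G : TwoForm 𝓘(ℂ, ℂ × ℂ) (ℂ × ℂ)) z
    ![((1, 0) : ℂ × ℂ), ((0, 1) : ℂ × ℂ)]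

theorem coeff_congr (s : TwoForm 𝓘(ℂ, ℂ × ℂ) S) {F G : ℂ × ℂ → S} {z : ℂ × ℂ}
    (h : F =ᶠ[𝓝 z] G) : s.coeff F z = s.coeff G z := by
  unfold coeff
  rw [pullback_congr s h]

/-- The change of variables formula. It reduces later comparisons of forms to Jacobians: of
translations, of point reflections, of `A`, of `(u, v) ↦ (u ^ 2, v)` and of the blow-down. -/
theorem coeff_comp (s : TwoForm 𝓘(ℂ, ℂ × ℂ) S) {G : ℂ × ℂ → S} {F : ℂ × ℂ → ℂ × ℂ}
    {z : ℂ × ℂ} {F' : ℂ × ℂ →L[ℂ] ℂ × ℂ}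
    (hG : MDifferentiableAt 𝓘(ℂ, ℂ × ℂ) 𝓘(ℂ, ℂ × ℂ) G (F z)) (hF : HasFDerivAt F F' z) :
    s.coeff (G ∘ F) z = s.coeff G (F z) * detForm ![F' (1, 0), F' (0, 1)] := by
  unfold coeff
  rw [pullback_comp s hG hF.differentiableAt.mdifferentiableAt, mfderiv_eq_fderiv, hF.fderiv]
  refine Eq.trans ?_ (apply_eq_mul_detForm _ _ _)
  exact congrArg (s.pullback G (F z)) (by ext i; fin_cases i <;> rfl)

variable [IsManifold 𝓘(ℂ, ℂ × ℂ) ω S]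

theorem IsSymplectic.differentiableAt_coeff {s : TwoForm 𝓘(ℂ, ℂ × ℂ) S} (hs : s.IsSymplectic)
    {G : ℂ × ℂ → S} {z : ℂ × ℂ} (hG : ContMDiffAt 𝓘(ℂ, ℂ × ℂ) 𝓘(ℂ, ℂ × ℂ) ω G z) :
    DifferentiableAt ℂ (s.coeff G) z := by
  set e := extChartAt 𝓘(ℂ, ℂ × ℂ) (G z) with he
  set F : ℂ × ℂ → ℂ × ℂ := fun w ↦ e (G w) with hFdef
  have hF : ContDiffAt ℂ ω F z :=
    ((contMDiffAt_extChartAt (n := ω) (I := 𝓘(ℂ, ℂ × ℂ))).comp z hG).contDiffAt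
  have hFz : F z ∈ e.target := mem_extChartAt_target _
  have ht : IsOpen e.target := isOpen_extChartAt_target (G z)
  have hFd : ∀ᶠ w in 𝓝 z, DifferentiableAt ℂ F w := by
    filter_upwards [hF.eventually (by simp)] with w hw
    exact hw.differentiableAt (by simp)
  have hsrc : ∀ᶠ w in 𝓝 z, G w ∈ e.source :=
    hG.continuousAt (extChartAt_source_mem_nhds (I := 𝓘(ℂ, ℂ × ℂ)) (G z))
  have key : s.coeff G =ᶠ[𝓝 z] fun w ↦ (s.inChart (G z) (F w)).compContinuousLinearMap
      (fderiv ℂ F w) ![((1, 0) : ℂ × ℂ), ((0, 1) : ℂ × ℂ)] := by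
    filter_upwards [hFd, hsrc.eventually_nhds, hF.continuousAt (ht.mem_nhds hFz)] with w h1 h2 h3
    have hcomp : G =ᶠ[𝓝 w] e.symm ∘ F := by
      filter_upwards [h2] with w' hw'
      exact (e.left_inv hw').symm
    unfold coeff
    rw [pullback_congr s hcomp, pullback_comp s (mdifferentiableAt_extChartAt_symm _ h3)
      h1.mdifferentiableAt, mfderiv_eq_fderiv]
    rfl
  refine DifferentiableAt.congr_of_eventuallyEq ?_ key
  have hd1 : DifferentiableAt ℂ (fun w ↦ s.inChart (G z) (F w)) z :=
    ((hs.holomorphic (G z)).differentiableAt (ht.mem_nhds hFz)).comp z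
      (hF.differentiableAt (by simp))
  have hd2 : DifferentiableAt ℂ (fderiv ℂ F) z :=
    (hF.fderiv_right (m := ω) (by simp)).differentiableAt (by simp)
  exact (ContinuousAlternatingMap.apply ℂ (ℂ × ℂ) ℂ
    ![((1, 0) : ℂ × ℂ), ((0, 1) : ℂ × ℂ)]).differentiableAt.comp z
      (hd1.continuousAlternatingMapCompContinuousLinearMap hd2)

-- Near `y` the identity is `G ∘ R`, so `θ y` is the pullback by `R` of the value of `G^* θ` at `R
-- y`, and that value is determined by its coefficient.
omit [IsManifold 𝓘(ℂ, ℂ × ℂ) ω S] in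
theorem eq_zero_of_coeff_eq_zero (θ : TwoForm 𝓘(ℂ, ℂ × ℂ) S) {G : ℂ × ℂ → S} {R : S → ℂ × ℂ}
    {y : S} (hR : MDifferentiableAt 𝓘(ℂ, ℂ × ℂ) 𝓘(ℂ, ℂ × ℂ) R y)
    (hG : MDifferentiableAt 𝓘(ℂ, ℂ × ℂ) 𝓘(ℂ, ℂ × ℂ) G (R y))
    (hGR : ∀ᶠ y' in 𝓝 y, G (R y') = y') (h : θ.coeff G (R y) = 0) : θ y = 0 := by
  have h0 : (θ.pullback G : TwoForm 𝓘(ℂ, ℂ × ℂ) (ℂ × ℂ)) (R y) = 0 := by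
    ext v
    have hv : v = ![v 0, v 1] := by
      ext i
      fin_cases i <;> rfl
    rw [hv]
    refine (apply_eq_mul_detForm _ _ _).trans ?_
    unfold coeff at h
    refine (congrArg (· * _) h).trans ?_
    rw [zero_mul]
    rfl
  have h1 := pullback_comp θ hG hR
  rw [h0, pullback_congr θ (f := G ∘ R) (g := fun y' ↦ y') hGR, pullback_id] at h1
  rw [h1]
  rfl

end TwoForm

/-! ### Gluing along a dense set -/

/-- Continuous functions that agree on a dense set with a given function glue. -/
theorem Dense.exists_glue {S X : Type*} [TopologicalSpace S] [TopologicalSpace X] [T2Space X]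
    {D : Set S} (hD : Dense D) (f₀ : S → X) (P : (S → X) → S → Prop)
    (hP : ∀ f y, P f y → ContinuousAt f y)
    (H : ∀ y, ∃ f : S → X, (∀ᶠ y' in 𝓝 y, P f y') ∧ ∀ᶠ y' in 𝓝 y, y' ∈ D → f y' = f₀ y') :
    ∃ F : S → X, Set.EqOn F f₀ D ∧ ∀ y, ∃ f : S → X, P f y ∧ F =ᶠ[𝓝 y] f := by
  choose f hf hfD using H
  refine ⟨fun y ↦ f y y, fun y hy ↦ (hfD y).self_of_nhds hy, fun y ↦
    ⟨f y, (hf y).self_of_nhds, ?_⟩⟩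
  -- The glued map uses at `z` the extension chosen for `z`. Both it and the one chosen for `y` are
  -- continuous at `z` and equal `f₀` on `D` near `z`, so their values at `z` are the same limit
  -- along `D`.
  filter_upwards [hf y, (hfD y).eventually_nhds] with z hz hzD
  have : (𝓝[D] z).NeBot := mem_closure_iff_nhdsWithin_neBot.mp (hD z)
  refine tendsto_nhds_unique (f := f₀) (l := 𝓝[D] z) ?_ ?_
  · refine ((hP _ _ (hf z).self_of_nhds).mono_left nhdsWithin_le_nhds).congr' ?_
    exact eventually_nhdsWithin_iff.mpr (hfD z)
  · refine ((hP _ _ hz).mono_left nhdsWithin_le_nhds).congr' ?_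
    exact eventually_nhdsWithin_iff.mpr hzD

/-! ### Fixed points of the involution and local sections -/

namespace ComplexTorus

variable {L : Submodule ℤ (ℂ × ℂ)}

/-- Fixed points are the images of half-lattice points; this moves the arguments about `κ` up to
`ℂ²`. -/
theorem neg_proj_ne_iff {z : ℂ × ℂ} : -proj L z ≠ proj L z ↔ z + z ∉ L := by
  have h : -proj L z = proj L (-z) := rfl
  rw [h, Ne, proj_eq_iff, sub_neg_eq_add]

variable [DiscreteTopology L]

variable (L) in
theorem isClosed_lattice : IsClosed (L : Set (ℂ × ℂ)) :=
  AddSubgroup.isClosed_of_discrete (H := L.toAddSubgroup)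

variable (L) in
theorem eventually_eq_zero_of_mem : ∀ᶠ w in 𝓝 (0 : ℂ × ℂ), w ∈ L → w = 0 := by
  obtain ⟨U, hU, hUL⟩ : ∃ U ∈ 𝓝 (0 : ℂ × ℂ), U ∩ (L : Set (ℂ × ℂ)) ⊆ {0} :=
    mem_nhdsWithin_iff_exists_mem_nhds_inter.mp (singleton_mem_nhdsWithin_of_mem_discrete
      (DiscreteTopology.isDiscrete (s := (L : Set (ℂ × ℂ)))) L.zero_mem)
  filter_upwards [hU] with w hw hwL
  exact hUL ⟨hw, hwL⟩

theorem eventually_add_self_notMem {X : Type*} [TopologicalSpace X] {f : X → ℂ × ℂ} {x : X}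
    (hf : ContinuousAt f x) (hx : f x + f x ∉ L) : ∀ᶠ y in 𝓝 x, f y + f y ∉ L :=
  (hf.add hf) ((isClosed_lattice L).isOpen_compl.mem_nhds hx)

/-- Local holomorphic sections of the projection `ℂ² → ℂ² / L`. -/
theorem exists_section (z : ℂ × ℂ) : ∃ r : ComplexTorus L → ℂ × ℂ,
    ContMDiffAt 𝓘(ℂ, ℂ × ℂ) 𝓘(ℂ, ℂ × ℂ) ω r (proj L z) ∧ r (proj L z) = z ∧
      ∀ᶠ x in 𝓝 (proj L z), proj L (r x) = x := by
  set e := chartAt (ℂ × ℂ) (proj L z) with he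
  have hsymm : ⇑e.symm = proj L := symm_eq_of_mem_atlas L (chart_mem_atlas _ _)
  have hmem : e (proj L z) - z ∈ L := by
    have h := e.left_inv (mem_chart_source (ℂ × ℂ) (proj L z))
    rw [hsymm] at h
    rw [← proj_eq_iff, h]
  refine ⟨fun x ↦ e x - (e (proj L z) - z), ?_, by simp, ?_⟩
  · have h1 : ContMDiffAt 𝓘(ℂ, ℂ × ℂ) 𝓘(ℂ, ℂ × ℂ) ω e (proj L z) :=
      contMDiffAt_of_mem_maximalAtlas (IsManifold.chart_mem_maximalAtlas _) (mem_chart_source _ _)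
    exact h1.sub contMDiffAt_const
  · filter_upwards [e.open_source.mem_nhds (mem_chart_source (ℂ × ℂ) (proj L z))] with x hx
    have h := e.left_inv hx
    rw [hsymm] at h
    conv_rhs => rw [← h]
    rw [proj_eq_iff]
    simpa using hmem

end ComplexTorus

open ComplexTorus

/-! ### Local structure of a Kummer surface -/

section Kummer

variable {L : Submodule ℤ (ℂ × ℂ)} [DiscreteTopology L]
  {S : Type*} [TopologicalSpace S] [ChartedSpace (ℂ × ℂ) S] {κ : ComplexTorus L → S}

/-- The parametrizations of the two standard affine charts of the projective line. -/
def IsLineChart (d : ℂ → ℂ × ℂ) : Prop :=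
  d = (fun v ↦ (1, v)) ∨ d = (fun v ↦ (v, 1))

theorem IsLineChart.ne_zero {d : ℂ → ℂ × ℂ} (hd : IsLineChart d) (v : ℂ) : d v ≠ 0 := by
  rcases hd with rfl | rfl <;> simp

theorem IsLineChart.contDiff {d : ℂ → ℂ × ℂ} (hd : IsLineChart d) : ContDiff ℂ ω d := by
  rcases hd with rfl | rfl
  · exact contDiff_const.prodMk contDiff_id
  · exact contDiff_id.prodMk contDiff_const

/-- In a Kummer chart, near each point of the exceptional curve, the map `κ` is
`a + u • d v ↦ (u ^ 2, v)`, and `a + u • d v` is not a fixed point for `u ≠ 0`. -/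
theorem IsKummerChart.exists_pos {a : ℂ × ℂ} {d : ℂ → ℂ × ℂ} {ψ : OpenPartialHomeomorph S (ℂ × ℂ)}
    (h : IsKummerChart κ (proj L a) d ψ) (hd : IsLineChart d) (ha : a + a ∈ L) (v₀ : ℂ) :
    ∃ ε > 0, ∀ u v : ℂ, u ≠ 0 → ‖u‖ < ε → ‖v - v₀‖ < ε → (u ^ 2, v) ∈ ψ.target ∧
      (a + u • d v) + (a + u • d v) ∉ L ∧ ψ.symm (u ^ 2, v) = κ (proj L (a + u • d v)) := by
  have hdc : Continuous d := hd.contDiff.continuous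
  have h1 : ∀ᶠ q : ℂ × ℂ in 𝓝 (0, v₀), (q.1 ^ 2, q.2) ∈ ψ.target := by
    have hc : ContinuousAt (fun q : ℂ × ℂ ↦ (q.1 ^ 2, q.2)) (0, v₀) := by fun_prop
    refine hc (ψ.open_target.mem_nhds ?_)
    simpa using h.zero_mem_target v₀
  -- Twice `a + u • d v` is `(2 * u) • d v` modulo `L`. A lattice vector this small is zero, whereas
  -- `d v` never vanishes.
  have h2 : ∀ᶠ q : ℂ × ℂ in 𝓝 (0, v₀), (2 * q.1) • d q.2 ∈ L → (2 * q.1) • d q.2 = 0 := by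
    have hc : ContinuousAt (fun q : ℂ × ℂ ↦ (2 * q.1) • d q.2) (0, v₀) := by fun_prop
    refine hc.eventually (p := fun w ↦ w ∈ L → w = 0) ?_
    simpa using eventually_eq_zero_of_mem L
  obtain ⟨ε, hε, H⟩ := Metric.eventually_nhds_iff.mp (h1.and h2)
  refine ⟨ε, hε, fun u v hu hu' hv ↦ ?_⟩
  obtain ⟨h3, h4⟩ := @H (u, v) (by
    rw [Prod.dist_eq, dist_eq_norm, dist_eq_norm]
    simpa using ⟨hu', hv⟩)
  refine ⟨h3, fun hmem ↦ ?_, h.symm_apply u v hu h3⟩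
  have h5 : (2 * u) • d v ∈ L := by
    have e : (2 * u) • d v = (a + u • d v) + (a + u • d v) - (a + a) := by
      rw [two_mul, add_smul]
      abel
    rw [e]
    exact L.sub_mem hmem ha
  rcases smul_eq_zero.mp (h4 h5) with h6 | h6
  · exact hu (by simpa using h6)
  · exact hd.ne_zero v h6

namespace IsKummerSurface

variable (hκ : IsKummerSurface κ)
include hκ

theorem apply_proj_eq_iff {z w : ℂ × ℂ} (hz : z + z ∉ L) (hw : w + w ∉ L) :
    κ (proj L z) = κ (proj L w) ↔ z - w ∈ L ∨ z + w ∈ L := by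
  rw [hκ.apply_eq_iff _ _ (neg_proj_ne_iff.mpr hz) (neg_proj_ne_iff.mpr hw)]
  have h : -proj L z = proj L (-z) := rfl
  rw [h, proj_eq_iff, proj_eq_iff, ← neg_mem_iff (x := -z - w)]
  simp [add_comm]

theorem contMDiffAt {z : ℂ × ℂ} (hz : z + z ∉ L) :
    ContMDiffAt 𝓘(ℂ, ℂ × ℂ) 𝓘(ℂ, ℂ × ℂ) ω (κ ∘ proj L) z :=
  (hκ.isLocalDiffeomorphOn ⟨proj L z, neg_proj_ne_iff.mpr hz⟩).contMDiffAt.comp z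
    (contMDiff_proj z)

/-- Local holomorphic sections of the map `ℂ² ⇢ S`. -/
theorem exists_section {z : ℂ × ℂ} (hz : z + z ∉ L) : ∃ R : S → ℂ × ℂ,
    ContMDiffAt 𝓘(ℂ, ℂ × ℂ) 𝓘(ℂ, ℂ × ℂ) ω R (κ (proj L z)) ∧ R (κ (proj L z)) = z ∧
      ∀ᶠ y in 𝓝 (κ (proj L z)), R y + R y ∉ L ∧ κ (proj L (R y)) = y := by
  obtain ⟨r, hr, hrz, hrp⟩ := ComplexTorus.exists_section (L := L) z
  have hloc := hκ.isLocalDiffeomorphOn ⟨proj L z, neg_proj_ne_iff.mpr hz⟩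
  set ρ := hloc.localInverse
  have hρ : ContMDiffAt 𝓘(ℂ, ℂ × ℂ) 𝓘(ℂ, ℂ × ℂ) ω ρ (κ (proj L z)) :=
    hloc.localInverse_contMDiffAt
  have hρz : ρ (κ (proj L z)) = proj L z :=
    hloc.localInverse_left_inv hloc.localInverse_mem_target
  have hR : ContMDiffAt 𝓘(ℂ, ℂ × ℂ) 𝓘(ℂ, ℂ × ℂ) ω (r ∘ ρ) (κ (proj L z)) := by
    refine ContMDiffAt.comp _ ?_ hρ
    rwa [hρz]
  have hRz : (r ∘ ρ) (κ (proj L z)) = z := by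
    simp [hρz, hrz]
  refine ⟨r ∘ ρ, hR, hRz, ?_⟩
  have h1 : ∀ᶠ y in 𝓝 (κ (proj L z)), proj L (r (ρ y)) = ρ y := by
    refine hρ.continuousAt.eventually (p := fun x ↦ proj L (r x) = x) ?_
    rwa [hρz]
  filter_upwards [h1, eventually_add_self_notMem hR.continuousAt (by rwa [hRz]),
    hloc.localInverse_eventuallyEq_right] with y h2 h3 h4
  refine ⟨h3, ?_⟩
  change κ (proj L (r (ρ y))) = y
  rw [h2]
  exact h4

/-- Otherwise a local section `R` at `κ (proj L z)` could be followed along `ψ.symm (u ^ 2, v₀) = κ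
(proj L (a + u • d v₀))` as `u → 0`. Its values tend to `z` and equal `±(a + u • d v₀)` modulo the
closed group `L`, so in the limit `z` is `±a` modulo `L`, a half-lattice point. -/
theorem apply_ne_symm_zero {a : ℂ × ℂ} {d : ℂ → ℂ × ℂ}
    {ψ : OpenPartialHomeomorph S (ℂ × ℂ)} (h : IsKummerChart κ (proj L a) d ψ)
    (hd : IsLineChart d) (ha : a + a ∈ L) (v₀ : ℂ) {z : ℂ × ℂ} (hz : z + z ∉ L) :
    κ (proj L z) ≠ ψ.symm (0, v₀) := by
  intro heq
  obtain ⟨R, hR, hRz, hRK⟩ := hκ.exists_section hz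
  obtain ⟨ε, hε, H⟩ := h.exists_pos hd ha v₀
  have hψ : ContinuousAt (fun u : ℂ ↦ ψ.symm (u ^ 2, v₀)) 0 := by
    refine ContinuousAt.comp (g := ψ.symm) (f := fun u : ℂ ↦ (u ^ 2, v₀)) ?_ (by fun_prop)
    refine ψ.continuousAt_symm ?_
    simpa using h.zero_mem_target v₀
  have hψ0 : ψ.symm ((0 : ℂ) ^ 2, v₀) = κ (proj L z) := by
    rw [heq]
    simp
  have hRψ : ContinuousAt (fun u : ℂ ↦ R (ψ.symm (u ^ 2, v₀))) 0 := by
    refine ContinuousAt.comp (g := R) ?_ hψ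
    rw [hψ0]
    exact hR.continuousAt
  have hlim1 : Filter.Tendsto (fun u : ℂ ↦ R (ψ.symm (u ^ 2, v₀))) (𝓝[≠] 0) (𝓝 z) := by
    have := hRψ.tendsto
    rw [hψ0, hRz] at this
    exact this.mono_left nhdsWithin_le_nhds
  have hlim2 : Filter.Tendsto (fun u : ℂ ↦ a + u • d v₀) (𝓝[≠] 0) (𝓝 a) := by
    have : ContinuousAt (fun u : ℂ ↦ a + u • d v₀) 0 := by fun_prop
    have := this.tendsto
    simp only [zero_smul, add_zero] at this
    exact this.mono_left nhdsWithin_le_nhds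
  have hcl : IsClosed {q : (ℂ × ℂ) × (ℂ × ℂ) | q.1 - q.2 ∈ L ∨ q.1 + q.2 ∈ L} :=
    ((isClosed_lattice L).preimage (continuous_fst.sub continuous_snd)).union
      ((isClosed_lattice L).preimage (continuous_fst.add continuous_snd))
  have hmem := hcl.mem_of_tendsto (hlim1.prodMk_nhds hlim2) (by
    have hψ' := hψ.tendsto
    rw [hψ0] at hψ'
    filter_upwards [self_mem_nhdsWithin, nhdsWithin_le_nhds (Metric.ball_mem_nhds (0 : ℂ) hε),
      (hψ'.mono_left nhdsWithin_le_nhds).eventually hRK] with u hu hu' hu''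
    obtain ⟨-, h2, h3⟩ := H u v₀ hu (by simpa using hu') (by simpa using hε)
    have h4 := hu''.2.trans h3
    exact (hκ.apply_proj_eq_iff hu''.1 h2).mp h4)
  apply hz
  rcases hmem with h1 | h1
  · have : z + z = (z - a) + (z - a) + (a + a) := by abel
    rw [this]
    exact L.add_mem (L.add_mem h1 h1) ha
  · have : z + z = (z + a) + (z + a) - (a + a) := by abel
    rw [this]
    exact L.sub_mem (L.add_mem h1 h1) ha

/-- The points of `S` off the image of the non-fixed points lie on the exceptional curves. -/
theorem exists_chart_of_forall_ne {y : S} (hy : ∀ z : ℂ × ℂ, z + z ∉ L → κ (proj L z) ≠ y) :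
    ∃ (a : ℂ × ℂ) (d : ℂ → ℂ × ℂ) (ψ : OpenPartialHomeomorph S (ℂ × ℂ)) (v₀ : ℂ), a + a ∈ L ∧
      IsLineChart d ∧ IsKummerChart κ (proj L a) d ψ ∧ y ∈ ψ.source ∧ ψ y = (0, v₀) := by
  obtain ⟨p, ψ, hp, hψ, hyψ, hy0⟩ := hκ.exceptional y (by
    intro x hx
    obtain ⟨z, rfl⟩ := surjective_proj L x
    exact hy z (neg_proj_ne_iff.mp hx))
  obtain ⟨a, rfl⟩ := surjective_proj L p
  have ha : a + a ∈ L := by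
    by_contra h
    exact neg_proj_ne_iff.mpr h hp
  rcases hψ with hψ | hψ
  · exact ⟨a, _, ψ, (ψ y).2, ha, Or.inl rfl, hψ, hyψ, Prod.ext hy0 rfl⟩
  · exact ⟨a, _, ψ, (ψ y).2, ha, Or.inr rfl, hψ, hyψ, Prod.ext hy0 rfl⟩

/-- The points near a point of an exceptional curve which are images of non-fixed points. -/
theorem eventually_exists_eq {a : ℂ × ℂ} {d : ℂ → ℂ × ℂ}
    {ψ : OpenPartialHomeomorph S (ℂ × ℂ)} (h : IsKummerChart κ (proj L a) d ψ)
    (hd : IsLineChart d) (ha : a + a ∈ L) {v₀ : ℂ} {y : S} (hy : y ∈ ψ.source)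
    (hy0 : ψ y = (0, v₀)) :
    ∃ ε > 0, (∀ u v : ℂ, u ≠ 0 → ‖u‖ < ε → ‖v - v₀‖ < ε → (u ^ 2, v) ∈ ψ.target ∧
      (a + u • d v) + (a + u • d v) ∉ L ∧ ψ.symm (u ^ 2, v) = κ (proj L (a + u • d v))) ∧
    ∀ᶠ y' in 𝓝 y, (∃ z : ℂ × ℂ, z + z ∉ L ∧ κ (proj L z) = y') →
      ∃ u v : ℂ, u ≠ 0 ∧ ‖u‖ < ε ∧ ‖v - v₀‖ < ε ∧ ψ y' = (u ^ 2, v) ∧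
        y' = κ (proj L (a + u • d v)) := by
  obtain ⟨ε, hε, H⟩ := h.exists_pos hd ha v₀
  refine ⟨ε, hε, H, ?_⟩
  have hc : ContinuousAt ψ y := ψ.continuousAt hy
  have hw : ∀ᶠ y' in 𝓝 y, ‖(ψ y').1‖ < ε ^ 2 := by
    have : ContinuousAt (fun y' ↦ ‖(ψ y').1‖) y := hc.fst.norm
    refine this.eventually_lt continuousAt_const ?_
    simp only [hy0, norm_zero]
    positivity
  have hv : ∀ᶠ y' in 𝓝 y, ‖(ψ y').2 - v₀‖ < ε := by
    have : ContinuousAt (fun y' ↦ ‖(ψ y').2 - v₀‖) y := (hc.snd.sub continuousAt_const).norm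
    refine this.eventually_lt continuousAt_const ?_
    simpa [hy0] using hε
  filter_upwards [hw, hv, ψ.open_source.mem_nhds hy] with y' hw hv hy' ⟨z, hz, hzy⟩
  -- Either square root will do: `a + u • d v` and `a - u • d v` are exchanged by the involution
  -- modulo `L`.
  obtain ⟨u, hu⟩ := IsAlgClosed.exists_pow_nat_eq (ψ y').1 two_pos
  have hψ' : ψ y' = (u ^ 2, (ψ y').2) := Prod.ext hu.symm rfl
  have hu0 : u ≠ 0 := by
    rintro rfl
    refine hκ.apply_ne_symm_zero h hd ha (ψ y').2 hz ?_
    rw [hzy]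
    conv_lhs => rw [← ψ.left_inv hy', hψ']
    simp
  have hun : ‖u‖ < ε := by
    rw [← hu, norm_pow] at hw
    exact lt_of_pow_lt_pow_left₀ 2 hε.le hw
  refine ⟨u, (ψ y').2, hu0, hun, hv, hψ', ?_⟩
  rw [← (H u _ hu0 hun hv).2.2, ← hψ', ψ.left_inv hy']

/-- A point with Kummer coordinates `(0, v₀)` is the limit of the points `(u ^ 2, v₀)` as `u → 0`.
-/
theorem dense : Dense {y : S | ∃ z : ℂ × ℂ, z + z ∉ L ∧ κ (proj L z) = y} := by
  intro y
  by_cases hy : ∃ z : ℂ × ℂ, z + z ∉ L ∧ κ (proj L z) = y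
  · exact subset_closure hy
  · push Not at hy
    obtain ⟨a, d, ψ, v₀, ha, hd, h, hyψ, hy0⟩ := hκ.exists_chart_of_forall_ne hy
    obtain ⟨ε, hε, H⟩ := h.exists_pos hd ha v₀
    have hψ : ContinuousAt (fun u : ℂ ↦ ψ.symm (u ^ 2, v₀)) 0 := by
      refine ContinuousAt.comp (g := ψ.symm) (f := fun u : ℂ ↦ (u ^ 2, v₀)) ?_ (by fun_prop)
      refine ψ.continuousAt_symm ?_
      simpa using h.zero_mem_target v₀
    have hψ' := hψ.tendsto
    have h0 : ψ.symm ((0 : ℂ) ^ 2, v₀) = y := by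
      rw [zero_pow two_ne_zero, ← hy0, ψ.left_inv hyψ]
    rw [h0] at hψ'
    refine mem_closure_of_tendsto (hψ'.mono_left (nhdsWithin_le_nhds (s := {0}ᶜ))) ?_
    filter_upwards [self_mem_nhdsWithin, nhdsWithin_le_nhds (Metric.ball_mem_nhds (0 : ℂ) hε)]
      with u hu hu'
    obtain ⟨-, h2, h3⟩ := H u v₀ hu (by simpa using hu') (by simpa using hε)
    exact ⟨_, h2, h3.symm⟩

end IsKummerSurface

/-! ### Linear maps and the blow-down in affine charts -/

/-- A linear automorphism of `ℂ²` acts on the projective line: in affine charts it is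
`v ↦ μ v`, with a nonvanishing factor `m v`. -/
theorem IsLineChart.exists_map {A : ℂ × ℂ →L[ℂ] ℂ × ℂ} (hA : Function.Injective A)
    {d : ℂ → ℂ × ℂ} (hd : IsLineChart d) (v₀ : ℂ) :
    ∃ (d' : ℂ → ℂ × ℂ) (m μ : ℂ → ℂ), IsLineChart d' ∧ ContDiffAt ℂ ω m v₀ ∧
      ContDiffAt ℂ ω μ v₀ ∧ m v₀ ≠ 0 ∧ ∀ v, m v ≠ 0 → A (d v) = m v • d' (μ v) := by
  have hAd : ContDiffAt ℂ ω (fun v ↦ A (d v)) v₀ :=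
    A.contDiff.contDiffAt.comp v₀ hd.contDiff.contDiffAt
  have hne : A (d v₀) ≠ 0 := by
    rw [← map_zero A]
    exact fun h ↦ hd.ne_zero v₀ (hA h)
  -- The target affine chart is one that contains the direction of `A (d v₀)`; `m` is the coordinate
  -- normalised to `1` there.
  by_cases h : (A (d v₀)).1 = 0
  · have h2 : (A (d v₀)).2 ≠ 0 := fun h2 ↦ hne (Prod.ext h h2)
    refine ⟨_, fun v ↦ (A (d v)).2, fun v ↦ (A (d v)).1 / (A (d v)).2, Or.inr rfl, hAd.snd,
      hAd.fst.div hAd.snd h2, h2, fun v hv ↦ Prod.ext ?_ ?_⟩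
    · simp [mul_div_cancel₀ _ hv]
    · simp
  · refine ⟨_, fun v ↦ (A (d v)).1, fun v ↦ (A (d v)).2 / (A (d v)).1, Or.inl rfl, hAd.fst,
      hAd.snd.div hAd.fst h, h, fun v hv ↦ Prod.ext ?_ ?_⟩
    · simp
    · simp [mul_div_cancel₀ _ hv]

/-- The blow-down has Jacobian `u` or `-u` according to the chart; `c` is that sign. -/
theorem IsLineChart.exists_hasFDerivAt {d : ℂ → ℂ × ℂ} (hd : IsLineChart d) (a : ℂ × ℂ) :
    ∃ c : ℂ, c * c = 1 ∧ ∃ P' : ℂ × ℂ → ℂ × ℂ →L[ℂ] ℂ × ℂ, ∀ q,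
      HasFDerivAt (fun q : ℂ × ℂ ↦ a + q.1 • d q.2) (P' q) q ∧
      detForm ![P' q (1, 0), P' q (0, 1)] = c * q.1 := by
  have h1 : ∀ q : ℂ × ℂ, HasFDerivAt (fun q : ℂ × ℂ ↦ q.1) (ContinuousLinearMap.fst ℂ ℂ ℂ) q :=
    fun q ↦ hasFDerivAt_fst
  have h2 : ∀ q : ℂ × ℂ, HasFDerivAt (fun q : ℂ × ℂ ↦ q.1 * q.2)
      (q.1 • ContinuousLinearMap.snd ℂ ℂ ℂ + q.2 • ContinuousLinearMap.fst ℂ ℂ ℂ) q :=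
    fun q ↦ hasFDerivAt_fst.mul hasFDerivAt_snd
  rcases hd with rfl | rfl
  · refine ⟨1, one_mul 1, fun q ↦ (ContinuousLinearMap.fst ℂ ℂ ℂ).prod
      (q.1 • ContinuousLinearMap.snd ℂ ℂ ℂ + q.2 • ContinuousLinearMap.fst ℂ ℂ ℂ), fun q ↦
      ⟨?_, ?_⟩⟩
    · refine HasFDerivAt.const_add a ?_
      simpa using (h1 q).prodMk (h2 q)
    · simp [detForm_apply]
  · refine ⟨-1, by norm_num, fun q ↦ (q.1 • ContinuousLinearMap.snd ℂ ℂ ℂ +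
      q.2 • ContinuousLinearMap.fst ℂ ℂ ℂ).prod (ContinuousLinearMap.fst ℂ ℂ ℂ), fun q ↦
      ⟨?_, ?_⟩⟩
    · refine HasFDerivAt.const_add a ?_
      simpa using (h2 q).prodMk (h1 q)
    · simp [detForm_apply]

/-! ### Induced self-maps and symplectic forms on the Kummer surface -/

namespace IsKummerSurface

variable (hκ : IsKummerSurface κ)
include hκ

theorem exists_kummerChart {d : ℂ → ℂ × ℂ} (hd : IsLineChart d) {a : ℂ × ℂ} (ha : a + a ∈ L) :
    ∃ ψ, IsKummerChart κ (proj L a) d ψ := by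
  have hp : -proj L a = proj L a := by
    by_contra h
    exact neg_proj_ne_iff.mp h ha
  rcases hd with rfl | rfl
  · exact (hκ.exists_chart _ hp).1
  · exact (hκ.exists_chart _ hp).2

variable [IsManifold 𝓘(ℂ, ℂ × ℂ) ω S]

/-- A linear automorphism of the torus induces a holomorphic self-map of the Kummer surface. -/
theorem exists_induced_map [T2Space S] {A : ℂ × ℂ →L[ℂ] ℂ × ℂ} (hA : Function.Injective A)
    (hAL : ∀ w, A w ∈ L ↔ w ∈ L) :
    ∃ φ : S → S, ContMDiff 𝓘(ℂ, ℂ × ℂ) 𝓘(ℂ, ℂ × ℂ) ω φ ∧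
      ∀ z, z + z ∉ L → φ (κ (proj L z)) = κ (proj L (A z)) := by
  have hAN : ∀ {z}, z + z ∉ L → A z + A z ∉ L := fun hz ↦ by
    rwa [← map_add, hAL]
  -- The chosen preimage does not matter: `A` preserves the relation `z - w ∈ L ∨ z + w ∈ L`.
  obtain ⟨φ₀, hφ₀⟩ : ∃ φ₀ : S → S, ∀ z, z + z ∉ L → φ₀ (κ (proj L z)) = κ (proj L (A z)) := by
    classical
    refine ⟨fun y ↦ if h : ∃ z : ℂ × ℂ, z + z ∉ L ∧ κ (proj L z) = y then
      κ (proj L (A h.choose)) else y, fun z hz ↦ ?_⟩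
    have h : ∃ w : ℂ × ℂ, w + w ∉ L ∧ κ (proj L w) = κ (proj L z) := ⟨z, hz, rfl⟩
    simp only [dif_pos h]
    obtain ⟨h1, h2⟩ := h.choose_spec
    rw [hκ.apply_proj_eq_iff h1 hz] at h2
    rw [hκ.apply_proj_eq_iff (hAN h1) (hAN hz), ← map_sub, ← map_add, hAL, hAL]
    exact h2
  obtain ⟨φ, hφD, hφ⟩ := hκ.dense.exists_glue φ₀
    (fun f y ↦ ContMDiffAt 𝓘(ℂ, ℂ × ℂ) 𝓘(ℂ, ℂ × ℂ) ω f y) (fun f y h ↦ h.continuousAt) (by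
    intro y
    suffices H : ∃ f : S → S, ContMDiffAt 𝓘(ℂ, ℂ × ℂ) 𝓘(ℂ, ℂ × ℂ) ω f y ∧ ∀ᶠ y' in 𝓝 y,
        y' ∈ {y : S | ∃ z : ℂ × ℂ, z + z ∉ L ∧ κ (proj L z) = y} → f y' = φ₀ y' by
      obtain ⟨f, hf, hf'⟩ := H
      exact ⟨f, (contMDiffAt_iff_contMDiffAt_nhds (by simp)).mp hf, hf'⟩
    by_cases hy : ∃ z : ℂ × ℂ, z + z ∉ L ∧ κ (proj L z) = y
    · obtain ⟨z, hz, rfl⟩ := hy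
      obtain ⟨R, hR, hRz, hRK⟩ := hκ.exists_section hz
      refine ⟨(κ ∘ proj L) ∘ A ∘ R, ?_, ?_⟩
      · refine ContMDiffAt.comp _ ?_ (A.contMDiff.contMDiffAt.comp _ hR)
        simp only [Function.comp_apply, hRz]
        exact hκ.contMDiffAt (hAN hz)
      · filter_upwards [hRK] with y' ⟨h1, h2⟩ _
        conv_rhs => rw [← h2, hφ₀ _ h1]
        rfl
    · push Not at hy
      obtain ⟨a, d, ψ, v₀, ha, hd, h, hyψ, hy0⟩ := hκ.exists_chart_of_forall_ne hy
      obtain ⟨ε, hε, H, Hev⟩ := hκ.eventually_exists_eq h hd ha hyψ hy0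
      obtain ⟨d', m, μ, hd', hm, hμ, hm0, hAd⟩ := hd.exists_map hA v₀
      have hAa : A a + A a ∈ L := by rwa [← map_add, hAL]
      obtain ⟨ψ', h'⟩ := hκ.exists_kummerChart hd' hAa
      -- From `A (a + u • d v) = A a + (u * m v) • d' (μ v)`, the new first coordinate is `(u * m v)
      -- ^ 2`, which depends on `u` only through `u ^ 2`.
      set Q : ℂ × ℂ → ℂ × ℂ := fun q ↦ (q.1 * m q.2 ^ 2, μ q.2) with hQdef
      have hQ : ContDiffAt ℂ ω Q (ψ y) := by
        have h1 : ContDiffAt ℂ ω (fun q : ℂ × ℂ ↦ m q.2) (ψ y) := by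
          refine ContDiffAt.comp (g := m) (ψ y) ?_ contDiffAt_snd
          rwa [hy0]
        have h2 : ContDiffAt ℂ ω (fun q : ℂ × ℂ ↦ μ q.2) (ψ y) := by
          refine ContDiffAt.comp (g := μ) (ψ y) ?_ contDiffAt_snd
          rwa [hy0]
        exact (contDiffAt_fst.mul (h1.pow 2)).prodMk h2
      have hψc : ContMDiffAt 𝓘(ℂ, ℂ × ℂ) 𝓘(ℂ, ℂ × ℂ) ω ψ y :=
        contMDiffAt_of_mem_maximalAtlas h.mem_maximalAtlas hyψ
      have hQψ : ContMDiffAt 𝓘(ℂ, ℂ × ℂ) 𝓘(ℂ, ℂ × ℂ) ω (Q ∘ ψ) y :=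
        hQ.contMDiffAt.comp y hψc
      have hQy : Q (ψ y) ∈ ψ'.target := by
        rw [hy0]
        simpa [hQdef] using h'.zero_mem_target (μ v₀)
      refine ⟨ψ'.symm ∘ Q ∘ ψ, ?_, ?_⟩
      · exact (contMDiffAt_symm_of_mem_maximalAtlas h'.mem_maximalAtlas hQy).comp y hQψ
      · have hmev : ∀ᶠ y' in 𝓝 y, m (ψ y').2 ≠ 0 := by
          have hmc : ContinuousAt (fun y' ↦ m (ψ y').2) y := by
            refine ContinuousAt.comp (g := m) ?_ hψc.continuousAt.snd
            rw [hy0]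
            exact hm.continuousAt
          refine hmc.eventually_ne ?_
          rwa [hy0]
        filter_upwards [Hev, hmev, hQψ.continuousAt (ψ'.open_target.mem_nhds hQy)]
          with y' h1 h2 h3 hy'
        obtain ⟨u, v, hu, huε, hvε, hψy', hKy'⟩ := h1 hy'
        obtain ⟨-, hN, -⟩ := H u v hu huε hvε
        have hQe : Q (ψ y') = ((u * m v) ^ 2, μ v) := by
          simp only [hQdef, hψy', mul_pow]
        rw [hψy'] at h2
        change Q (ψ y') ∈ ψ'.target at h3
        rw [hQe] at h3
        change ψ'.symm (Q (ψ y')) = _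
        rw [hQe, h'.symm_apply _ _ (mul_ne_zero hu h2) h3, hKy', hφ₀ _ hN, map_add, map_smul,
          hAd v h2, smul_smul]
        rfl)
  refine ⟨φ, fun y ↦ ?_, fun z hz ↦ ?_⟩
  · obtain ⟨f, hf, hφf⟩ := hφ y
    exact hf.congr_of_eventuallyEq hφf
  · rw [hφD ⟨z, hz, rfl⟩, hφ₀ z hz]

/-- The pullback to `ℂ²` of a symplectic form on a Kummer surface has constant coefficient. -/
theorem exists_coeff_eq [CompactSpace S] [ConnectedSpace S] {s : TwoForm 𝓘(ℂ, ℂ × ℂ) S}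
    (hs : s.IsSymplectic) : ∃ C, ∀ z, z + z ∉ L → s.coeff (κ ∘ proj L) z = C := by
  have hmd : ∀ {z}, z + z ∉ L →
      MDifferentiableAt 𝓘(ℂ, ℂ × ℂ) 𝓘(ℂ, ℂ × ℂ) (κ ∘ proj L) z := fun hz ↦
    (hκ.contMDiffAt hz).mdifferentiableAt (by simp)
  have hwd : ∀ z w, z + z ∉ L → w + w ∉ L → κ (proj L z) = κ (proj L w) →
      s.coeff (κ ∘ proj L) z = s.coeff (κ ∘ proj L) w := by
    intro z w hz hw h
    -- The preimages differ by a translation or by a point reflection; in dimension two both have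
    -- Jacobian `1`.
    rcases (hκ.apply_proj_eq_iff hz hw).mp h with h1 | h1
    · have hev : κ ∘ proj L = (κ ∘ proj L) ∘ (fun p ↦ p + (z - w)) := by
        funext p
        simp only [Function.comp_apply]
        congr 1
        rw [proj_eq_iff]
        simpa using h1
      have e : w + (z - w) = z := by abel
      conv_rhs => rw [hev]
      have hF : HasFDerivAt (fun p ↦ p + (z - w)) (ContinuousLinearMap.id ℂ (ℂ × ℂ)) w :=
        (hasFDerivAt_id w).add_const _
      rw [s.coeff_comp (by rw [e]; exact hmd hz) hF, e]
      simp [detForm_apply]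
    · have hev : (κ ∘ proj L) =ᶠ[𝓝 w] (κ ∘ proj L) ∘ (fun p ↦ (z + w) - p) := by
        filter_upwards [eventually_add_self_notMem continuousAt_id hw] with p hp
        simp only [id] at hp
        have hp' : (z + w - p) + (z + w - p) ∉ L := by
          intro hmem
          apply hp
          have : p + p = (z + w) + (z + w) - ((z + w - p) + (z + w - p)) := by abel
          rw [this]
          exact L.sub_mem (L.add_mem h1 h1) hmem
        exact (hκ.apply_proj_eq_iff hp hp').mpr (Or.inr (by simpa using h1))
      have e : (z + w) - w = z := by abel
      have hF : HasFDerivAt (fun p ↦ (z + w) - p) (-ContinuousLinearMap.id ℂ (ℂ × ℂ)) w :=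
        (hasFDerivAt_id w).const_sub _
      rw [s.coeff_congr hev, s.coeff_comp (by rw [e]; exact hmd hz) hF, e]
      simp [detForm_apply]
  obtain ⟨f₀, hf₀⟩ : ∃ f₀ : S → ℂ, ∀ z, z + z ∉ L →
      f₀ (κ (proj L z)) = s.coeff (κ ∘ proj L) z := by
    classical
    refine ⟨fun y ↦ if h : ∃ z : ℂ × ℂ, z + z ∉ L ∧ κ (proj L z) = y then
      s.coeff (κ ∘ proj L) h.choose else 0, fun z hz ↦ ?_⟩
    have h : ∃ w : ℂ × ℂ, w + w ∉ L ∧ κ (proj L w) = κ (proj L z) := ⟨z, hz, rfl⟩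
    simp only [dif_pos h]
    exact hwd _ _ h.choose_spec.1 hz h.choose_spec.2
  obtain ⟨f, hfD, hf⟩ := hκ.dense.exists_glue f₀
    (fun f y ↦ MDifferentiableAt 𝓘(ℂ, ℂ × ℂ) 𝓘(ℂ, ℂ) f y) (fun f y h ↦ h.continuousAt) (by
    intro y
    by_cases hy : ∃ z : ℂ × ℂ, z + z ∉ L ∧ κ (proj L z) = y
    · obtain ⟨z, hz, rfl⟩ := hy
      obtain ⟨R, hR, hRz, hRK⟩ := hκ.exists_section hz
      refine ⟨s.coeff (κ ∘ proj L) ∘ R, ?_, ?_⟩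
      · filter_upwards [(contMDiffAt_iff_contMDiffAt_nhds (by simp)).mp hR, hRK] with y' h1 h2
        exact MDifferentiableAt.comp y'
          (hs.differentiableAt_coeff (hκ.contMDiffAt h2.1)).mdifferentiableAt
          (h1.mdifferentiableAt (by simp))
      · filter_upwards [hRK] with y' ⟨h1, h2⟩ _
        conv_rhs => rw [← h2, hf₀ _ h1]
        rfl
    · push Not at hy
      obtain ⟨a, d, ψ, v₀, ha, hd, h, hyψ, hy0⟩ := hκ.exists_chart_of_forall_ne hy
      obtain ⟨ε, hε, H, Hev⟩ := hκ.eventually_exists_eq h hd ha hyψ hy0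
      obtain ⟨c, hc, P', hP'⟩ := hd.exists_hasFDerivAt a
      -- The map `(u, v) ↦ (u ^ 2, v)` has Jacobian `2 * u` and the blow-down `c * u`. The factors
      -- `u` cancel in the quotient, and `1 / c = c`, so the coefficient extends across the
      -- exceptional curve.
      refine ⟨fun y ↦ 2 * c * s.coeff ψ.symm (ψ y), ?_, ?_⟩
      · filter_upwards [ψ.open_source.mem_nhds hyψ] with y' hy'
        have h1 : MDifferentiableAt 𝓘(ℂ, ℂ × ℂ) 𝓘(ℂ, ℂ) (s.coeff ψ.symm ∘ ψ) y' :=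
          MDifferentiableAt.comp y' (hs.differentiableAt_coeff
            (contMDiffAt_symm_of_mem_maximalAtlas h.mem_maximalAtlas
              (ψ.map_source hy'))).mdifferentiableAt
            ((contMDiffAt_of_mem_maximalAtlas h.mem_maximalAtlas hy').mdifferentiableAt (by simp))
        exact h1.const_smul (2 * c)
      · filter_upwards [Hev] with y' h1 hy'
        obtain ⟨u, v, hu, huε, hvε, hψy', hKy'⟩ := h1 hy'
        obtain ⟨ht, hN, -⟩ := H u v hu huε hvε
        have hQ : HasFDerivAt (fun q : ℂ × ℂ ↦ (q.1 ^ 2, q.2))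
            (((2 * u) • ContinuousLinearMap.fst ℂ ℂ ℂ).prod (ContinuousLinearMap.snd ℂ ℂ ℂ))
            (u, v) := by
          refine HasFDerivAt.prodMk ?_ hasFDerivAt_snd
          simpa using (hasFDerivAt_fst (𝕜 := ℂ) (p := ((u, v) : ℂ × ℂ))).pow 2
        have hev : ψ.symm ∘ (fun q : ℂ × ℂ ↦ (q.1 ^ 2, q.2)) =ᶠ[𝓝 (u, v)]
            (κ ∘ proj L) ∘ fun q : ℂ × ℂ ↦ a + q.1 • d q.2 := by
          have c1 : ∀ᶠ q : ℂ × ℂ in 𝓝 (u, v), q.1 ≠ 0 := continuousAt_fst.eventually_ne hu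
          have c2 : ∀ᶠ q : ℂ × ℂ in 𝓝 (u, v), ‖q.1‖ < ε :=
            continuousAt_fst.norm.eventually_lt continuousAt_const huε
          have c3 : ∀ᶠ q : ℂ × ℂ in 𝓝 (u, v), ‖q.2 - v₀‖ < ε :=
            (continuousAt_snd.sub continuousAt_const).norm.eventually_lt continuousAt_const hvε
          filter_upwards [c1, c2, c3] with q h1 h2 h3
          exact (H q.1 q.2 h1 h2 h3).2.2
        have e1 := s.coeff_comp (G := ψ.symm) (F := fun q : ℂ × ℂ ↦ (q.1 ^ 2, q.2)) (z := (u, v))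
          ((contMDiffAt_symm_of_mem_maximalAtlas h.mem_maximalAtlas ht).mdifferentiableAt (by simp))
          hQ
        have e2 := s.coeff_comp (F := fun q : ℂ × ℂ ↦ a + q.1 • d q.2) (z := (u, v)) (hmd hN)
          (hP' (u, v)).1
        rw [s.coeff_congr hev, e2, (hP' (u, v)).2] at e1
        simp [detForm_apply] at e1
        rw [hψy', hKy', hf₀ _ hN]
        refine mul_right_cancel₀ (mul_ne_zero (left_ne_zero_of_mul_eq_one hc) hu) ?_
        rw [e1]
        linear_combination (2 * u * s.coeff ψ.symm (u ^ 2, v)) * hc)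
  have hfd : MDifferentiable 𝓘(ℂ, ℂ × ℂ) 𝓘(ℂ, ℂ) f := fun y ↦ by
    obtain ⟨f', h1, h2⟩ := hf y
    exact h1.congr_of_eventuallyEq h2
  -- Maximum principle on the compact connected surface.
  obtain ⟨C, hC⟩ := hfd.exists_eq_const_of_compactSpace
  refine ⟨C, fun z hz ↦ ?_⟩
  rw [← hf₀ z hz, ← hfD ⟨z, hz, rfl⟩, hC]
  rfl

/-- The self-map of a Kummer surface induced by a linear automorphism of the torus multiplies
the symplectic forms by the determinant. -/
theorem pullback_eq_smul [CompactSpace S] [ConnectedSpace S] {A : ℂ × ℂ →L[ℂ] ℂ × ℂ}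
    (hAL : ∀ w, A w ∈ L ↔ w ∈ L) {φ : S → S}
    (hφ : ContMDiff 𝓘(ℂ, ℂ × ℂ) 𝓘(ℂ, ℂ × ℂ) ω φ)
    (hφA : ∀ z, z + z ∉ L → φ (κ (proj L z)) = κ (proj L (A z)))
    {s : TwoForm 𝓘(ℂ, ℂ × ℂ) S} (hs : s.IsSymplectic) :
    s.pullback φ = detForm ![A (1, 0), A (0, 1)] • s := by
  set c := detForm ![A (1, 0), A (0, 1)] with hc
  obtain ⟨C, hC⟩ := hκ.exists_coeff_eq hs
  set θ : TwoForm 𝓘(ℂ, ℂ × ℂ) S := s.pullback φ - c • s with hθ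
  have hcoeff : ∀ {G : ℂ × ℂ → S} {z : ℂ × ℂ},
      MDifferentiableAt 𝓘(ℂ, ℂ × ℂ) 𝓘(ℂ, ℂ × ℂ) G z →
      θ.coeff G z = s.coeff (φ ∘ G) z - c * s.coeff G z := by
    intro G z hG
    unfold TwoForm.coeff
    rw [TwoForm.pullback_comp s ((hφ _).mdifferentiableAt (by simp)) hG]
    rfl
  -- Since `φ ∘ κ ∘ proj L = κ ∘ proj L ∘ A` near `z`, the coefficient of `φ^* s` is the one of `s`
  -- at `A z` times `det A`. The coefficient of `s` is the same constant at `z` and `A z`.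
  have hD : ∀ z, z + z ∉ L → θ (κ (proj L z)) = 0 := by
    intro z hz
    obtain ⟨R, hR, hRz, hRK⟩ := hκ.exists_section hz
    have hmd := (hκ.contMDiffAt hz).mdifferentiableAt (by simp)
    have hAz : A z + A z ∉ L := by rwa [← map_add, hAL]
    refine TwoForm.eq_zero_of_coeff_eq_zero θ (G := κ ∘ proj L) (hR.mdifferentiableAt (by simp))
      (by rwa [hRz]) (hRK.mono fun _ h ↦ h.2) ?_
    have hev : φ ∘ (κ ∘ proj L) =ᶠ[𝓝 z] (κ ∘ proj L) ∘ A := by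
      filter_upwards [eventually_add_self_notMem continuousAt_id hz] with w hw
      exact hφA w hw
    rw [hRz, hcoeff hmd, s.coeff_congr hev, s.coeff_comp
      ((hκ.contMDiffAt hAz).mdifferentiableAt (by simp)) A.hasFDerivAt, hC _ hAz, hC _ hz]
    ring
  have hall : ∀ y, θ y = 0 := by
    intro y
    set e := chartAt (ℂ × ℂ) y with he
    have heA : e ∈ IsManifold.maximalAtlas 𝓘(ℂ, ℂ × ℂ) ω S := IsManifold.chart_mem_maximalAtlas _
    have hy : y ∈ e.source := mem_chart_source _ _
    have hsym : ∀ y' ∈ e.source, ContMDiffAt 𝓘(ℂ, ℂ × ℂ) 𝓘(ℂ, ℂ × ℂ) ω e.symm (e y') :=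
      fun y' hy' ↦ contMDiffAt_symm_of_mem_maximalAtlas heA (e.map_source hy')
    refine TwoForm.eq_zero_of_coeff_eq_zero θ (G := e.symm) (R := e)
      ((contMDiffAt_of_mem_maximalAtlas heA hy).mdifferentiableAt (by simp))
      ((hsym y hy).mdifferentiableAt (by simp)) ?_ ?_
    · filter_upwards [e.open_source.mem_nhds hy] with y' hy'
      exact e.left_inv hy'
    -- The coefficient of `θ` in a chart is continuous and vanishes on the dense set, hence also at
    -- `y`.
    · have hcont : ContinuousAt (fun y' ↦ s.coeff (φ ∘ e.symm) (e y') - c * s.coeff e.symm (e y'))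
          y := by
        have h1 := (hs.differentiableAt_coeff ((hφ _).comp _ (hsym y hy))).continuousAt
        have h2 := (hs.differentiableAt_coeff (hsym y hy)).continuousAt
        have h3 := e.continuousAt hy
        exact (ContinuousAt.comp (f := e) h1 h3).sub
          (continuousAt_const.mul (ContinuousAt.comp (f := e) h2 h3))
      rw [hcoeff ((hsym y hy).mdifferentiableAt (by simp))]
      have : (𝓝[{y : S | ∃ z : ℂ × ℂ, z + z ∉ L ∧ κ (proj L z) = y}] y).NeBot :=
        mem_closure_iff_nhdsWithin_neBot.mp (hκ.dense y)
      refine tendsto_nhds_unique (l := 𝓝[{y : S | ∃ z : ℂ × ℂ, z + z ∉ L ∧ κ (proj L z) = y}] y)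
        (hcont.tendsto.mono_left nhdsWithin_le_nhds)
        (tendsto_const_nhds.congr' ?_)
      filter_upwards [self_mem_nhdsWithin, nhdsWithin_le_nhds (e.open_source.mem_nhds hy)]
        with y' ⟨z, hz, hzy⟩ hy'
      rw [← hcoeff ((hsym y' hy').mdifferentiableAt (by simp))]
      unfold TwoForm.coeff TwoForm.pullback
      have h0 : θ (e.symm (e y')) = 0 := by
        rw [e.left_inv hy', ← hzy]
        exact hD z hz
      rw [h0]
      rfl
  funext y
  exact sub_eq_zero.mp (hall y)

end IsKummerSurface

end Kummer

/-! ### The linear part of the automorphism and the conclusion -/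

/-- The linear part of an automorphism of a complex torus. -/
theorem ComplexTorus.exists_linear_part {L : Submodule ℤ (ℂ × ℂ)} [DiscreteTopology L]
    [IsZLattice ℝ L]
    (g : Diffeomorph 𝓘(ℂ, ℂ × ℂ) 𝓘(ℂ, ℂ × ℂ) (ComplexTorus L) (ComplexTorus L) ω)
    {lam : ℂ} (hg : (standardForm L).pullback g = lam • standardForm L) :
    ∃ A : ℂ × ℂ →L[ℂ] ℂ × ℂ, (∀ z, g (proj L z) = proj L (A z) + g 0) ∧
      (∀ w, A w ∈ L ↔ w ∈ L) ∧ Function.Injective A ∧ detForm ![A (1, 0), A (0, 1)] = lam ∧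
      lam ≠ 0 := by
  obtain ⟨A, hA, hdA⟩ := exists_affine g.contMDiff
  have hbij : Function.Bijective A := by
    have h := (g.mfderivToContinuousLinearEquiv (by simp) (proj L 0)).bijective
    have e : ⇑(g.mfderivToContinuousLinearEquiv (by simp) (proj L 0)) = A := by
      rw [← hdA 0]
      rfl
    rwa [e] at h
  -- The hypothesis on `dz₁ ∧ dz₂`, read at the origin, where the differential of `g` is `A`.
  have hdet : ∀ v w, detForm ![A v, A w] = lam * detForm ![v, w] := by
    intro v w
    have h := congrArg (fun η : (ℂ × ℂ) [⋀^Fin 2]→L[ℂ] ℂ ↦ η ![v, w]) (congrFun hg (proj L 0))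
    refine Eq.trans ?_ h
    refine Eq.symm ((TwoForm.pullback_apply (standardForm L) g (proj L 0) v w).trans ?_)
    rw [hdA]
    rfl
  have hproj : ∀ {w}, proj L w = 0 ↔ w ∈ L := fun {w} ↦ by
    rw [show (0 : ComplexTorus L) = proj L 0 from rfl, proj_eq_iff, zero_sub, neg_mem_iff]
  refine ⟨A, hA, fun w ↦ ?_, hbij.1, ?_, ?_⟩
  -- Injectivity of `g` on the torus is what gives `A w ∈ L → w ∈ L`.
  · have e : g (proj L w) = g 0 ↔ proj L w = 0 := g.injective.eq_iff
    rw [hA, add_eq_right] at e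
    rw [← hproj, ← hproj, e]
  · rw [hdet]
    simp [detForm_apply]
  · rintro rfl
    obtain ⟨v, hv⟩ := hbij.2 (1, 0)
    obtain ⟨w, hw⟩ := hbij.2 (0, 1)
    have := hdet v w
    rw [hv, hw] at this
    simp [detForm_apply] at this

/-- The closure of the image in `S × S` of the graph of an automorphism of the torus is the graph
of the induced self-map of the Kummer surface. -/
theorem IsKummerSurface.closure_graph {L : Submodule ℤ (ℂ × ℂ)} [DiscreteTopology L]
    {S : Type*} [TopologicalSpace S] [T2Space S] [ChartedSpace (ℂ × ℂ) S] {κ : ComplexTorus L → S}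
    (hκ : IsKummerSurface κ) {A : ℂ × ℂ → ℂ × ℂ} {g₀ : ComplexTorus L → ComplexTorus L}
    (hg₀ : ∀ z, g₀ (proj L z) = proj L (A z)) {φ : S → S} (hφ : Continuous φ)
    (hφA : ∀ z, z + z ∉ L → φ (κ (proj L z)) = κ (proj L (A z))) :
    closure {y : S × S | ∃ x : ComplexTorus L, -x ≠ x ∧ y = (κ (g₀ x), κ x)} =
      {y : S × S | y.1 = φ y.2} := by
  apply subset_antisymm
  · refine closure_minimal ?_ (isClosed_eq continuous_fst (hφ.comp continuous_snd))
    rintro _ ⟨x, hx, rfl⟩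
    obtain ⟨z, rfl⟩ := surjective_proj L x
    change κ (g₀ (proj L z)) = φ (κ (proj L z))
    rw [hφA z (neg_proj_ne_iff.mp hx), hg₀]
  · rintro ⟨a, y⟩ h
    obtain rfl : a = φ y := h
    have hmem := image_closure_subset_closure_image (f := fun y ↦ (φ y, y))
      (hφ.prodMk continuous_id) (Set.mem_image_of_mem _ (hκ.dense y))
    refine closure_mono ?_ hmem
    rintro _ ⟨_, ⟨z, hz, rfl⟩, rfl⟩
    refine ⟨proj L z, neg_proj_ne_iff.mpr hz, ?_⟩
    simp only [hφA z hz, hg₀]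

theorem corollary6p3 (L : Submodule ℤ (ℂ × ℂ)) [DiscreteTopology L] [IsZLattice ℝ L]
    (g : Diffeomorph 𝓘(ℂ, ℂ × ℂ) 𝓘(ℂ, ℂ × ℂ) (ComplexTorus L) (ComplexTorus L) ω)
    (lam : ℂ) (hlam : ∀ n : ℕ, n ≠ 0 → lam ^ n ≠ 1)
    (hg : ∀ σ : TwoForm 𝓘(ℂ, ℂ × ℂ) (ComplexTorus L), σ.IsSymplectic →
      σ.pullback g = lam • σ) :
    (∀ s : TwoForm 𝓘(ℂ, ℂ × ℂ) (ComplexTorus L), s.IsSymplectic →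
      IsLagrangianSurface (s.prod (-lam • s))
        {y : ComplexTorus L × ComplexTorus L | y.1 = g y.2}) ∧
    (∀ (S : Type*) [TopologicalSpace S] [T2Space S] [CompactSpace S] [ConnectedSpace S]
      [ChartedSpace (ℂ × ℂ) S] [IsManifold 𝓘(ℂ, ℂ × ℂ) ω S] (κ : ComplexTorus L → S),
      IsKummerSurface κ →
      ∀ s : TwoForm 𝓘(ℂ, ℂ × ℂ) S, s.IsSymplectic →
        IsLagrangianSurface (s.prod (-lam • s))
          (closure {y : S × S | ∃ x : ComplexTorus L, -x ≠ x ∧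
            y = (κ (g x - g 0), κ x)})) := by
  obtain ⟨A, hA, hAL, hAinj, hdet, hlam0⟩ :=
    exists_linear_part g (hg _ isSymplectic_standardForm)
  refine ⟨fun s hs ↦ ?_, fun S _ _ _ _ _ _ κ hκ s hs ↦ ?_⟩
  · have : ConnectedSpace (ComplexTorus L) := (surjective_proj L).connectedSpace (continuous_proj L)
    have : T2Space (ComplexTorus L) := by
      have : IsClosed (L.toAddSubgroup : Set (ℂ × ℂ)) := isClosed_lattice L
      infer_instance
    exact isLagrangianSurface_graph g.contMDiff hlam0 hs (hg s hs)
  · obtain ⟨φ, hφ, hφA⟩ := hκ.exists_induced_map hAinj hAL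
    have hg₀ : ∀ z, g (proj L z) - g 0 = proj L (A z) := fun z ↦ by
      rw [hA, add_sub_cancel_right]
    rw [hκ.closure_graph (g₀ := fun x ↦ g x - g 0) hg₀ hφ.continuous hφA]
    refine isLagrangianSurface_graph hφ hlam0 hs ?_
    rw [← hdet]
    exact hκ.pullback_eq_smul hAL hφ hφA hs
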